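/- **Definitions.** Let $T$ be a topological space. A stochastic process on $T$ is a family $X=\{X_t\}_{t\in T}$ of real random variables on a probability space. If its one-dimensional margins are identical, with upper endpoint $\tau_{\mathrm{up}}\in(-\infty,\infty]$, its tail correlation function (TCF), if it exists, is $$\chi^{(X)}(s,t)=\lim_{\tau\uparrow\tau_{\mathrm{up}}}P(X_s>\tau\mid X_t>\tau),\qquad s,t\in T .$$ $\mathrm{TCF}(T)$ denotes the set of all functions on $T\times T$ that arise in this way. The process $X$ is *stochastically continuous* if $X_s\to X_t$ in probability as $s\to t$, for every $t\in T$. It is *simple max-stable* if $P(X_t\le x)=e^{-1/x}$ for all $t\in T$, $x>0$, and if for every $n\ge 1$ the pointwise maximum of $n$ independent copies of $X$ has the same finite-dimensional distributions as $nX$. Its extremal coefficient function on the finite subsets of $T$ is $\theta(\emptyset)=0$ and $\theta(A)=-\tau\log P(\max_{t\in A}X_t\le\tau)$ for $A\neq\emptyset$ (the same for every $\tau>0$); $\Theta(T)$ is the set of all extremal coefficient functions of simple max-stable processes on $T$. A *Tawn–Molchanov process* is a process whose finite-dimensional distributions are, for some $\theta\in\Theta(T)$, $$-\log P(X_t\le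 x_t,\ t\in A)=\sum_{\emptyset\ne B\subset A}\Big(\sum_{I\subset B}(-1)^{|I|+1}\,\theta\big((A\setminus B)\cup I\big)\Big)\max_{t\in B}\frac1{x_t}$$ for all finite $A\subset T$ and all $x_t>0$, $t\in A$. **Statement.** Let $\chi\in \mathrm{TCF}(T)$. Then the following are equivalent: 1. $\chi$ is continuous on $T\times T$; 2. $\chi$ is continuous at every point $(t,t)$, $t\in T$, of the diagonal; 3. there is a stochastically continuous simple max-stable process $X$ on $T$ with $\chi^{(X)}=\chi$; 4. there is a stochastically continuous Tawn–Molchanov process $X$ on $T$ with $\chi^{(X)}=\chi$. Moreover, whether or not these conditions hold, there is a Tawn–Molchanov process on $T$ with TCF $\chi$, and every Tawn–Molchanov process on $T$ with TCF $\chi$ is stochastically continuous if and only if $\chi$ is continuous. -/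

import Mathlib

universe u v w

open MeasureTheory ProbabilityTheory Filter Topology Set

noncomputable section

namespace TailCorrelation

/-- `X` is a real-valued stochastic process on the index set `T`: each `X t` is a random variable. -/
def IsProcess {T : Type u} {Ω : Type v} [MeasurableSpace Ω] (X : T → Ω → ℝ) : Prop :=
  ∀ t, Measurable (X t)

/-- All the variables `X t` have the same distribution. -/
def HasIdenticalMargins {T : Type u} {Ω : Type v} [MeasurableSpace Ω]
    (X : T → Ω → ℝ) (P : Measure Ω) : Prop :=
  ∀ s t, P.map (X s) = P.map (X t)

/-- The upper endpoint `sup {x | F x < 1}` (possibly `∞`) of a distribution on the line with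
distribution function `F`. -/
def upperEndpoint (ν : Measure ℝ) : EReal :=
  sSup ((fun x : ℝ => (x : EReal)) '' {x : ℝ | cdf ν x < 1})

/-- `τ → τ_up` with `τ < τ_up` real, so that the event `{X t > τ}` has positive probability. -/
def toUpperEndpoint (ν : Measure ℝ) : Filter ℝ :=
  comap (fun x : ℝ => (x : EReal)) (𝓝[<] upperEndpoint ν)

/-- The process `X` has identical one-dimensional margins and its tail correlation function
exists and equals `χ`: `P (X s > τ | X t > τ) → χ (s, t)` as `τ` tends to the upper endpoint. -/
def HasTCF {T : Type u} {Ω : Type v} [MeasurableSpace Ω]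
    (X : T → Ω → ℝ) (P : Measure Ω) (χ : T × T → ℝ) : Prop :=
  HasIdenticalMargins X P ∧
    ∀ s t, Tendsto (fun τ : ℝ => (cond P {ω | τ < X t ω}).real {ω | τ < X s ω})
      (toUpperEndpoint (P.map (X t))) (𝓝 (χ (s, t)))

/-- The set of all tail correlation functions of stochastic processes on `T`. -/
def TCF (T : Type u) : Set (T × T → ℝ) :=
  {χ | ∃ (Ω : Type v) (_ : MeasurableSpace Ω) (P : Measure Ω) (X : T → Ω → ℝ),
    IsProbabilityMeasure P ∧ IsProcess X ∧ HasTCF X P χ}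

/-- Stochastic continuity: `X s → X t` in probability as `s → t`, for every `t`. -/
def StochasticallyContinuous {T : Type u} [TopologicalSpace T] {Ω : Type v} [MeasurableSpace Ω]
    (X : T → Ω → ℝ) (P : Measure Ω) : Prop :=
  ∀ t, TendstoInMeasure P X (𝓝 t) (X t)

/-- Simple max-stable processes: unit Fréchet margins, and for every `n ≥ 1` the pointwise maximum
of `n` independent copies of `X` (realized on the `n`-fold product space) has the same
finite-dimensional distributions as `n X`. -/
structure IsSimpleMaxStable {T : Type u} {Ω : Type v} [MeasurableSpace Ω]
    (X : T → Ω → ℝ) (P : Measure Ω) : Prop where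
  isProcess : IsProcess X
  frechet : ∀ t, ∀ x : ℝ, 0 < x → P.real {ω | X t ω ≤ x} = Real.exp (-1 / x)
  maxStable : ∀ n : ℕ, 0 < n → ∀ A : Finset T,
    (Measure.pi fun _ : Fin n => P).map
        (fun (ω : Fin n → Ω) (t : A) => ⨆ i : Fin n, X t (ω i)) =
      P.map (fun (ω : Ω) (t : A) => (n : ℝ) * X t ω)

/-- `θ` is the extremal coefficient function of the simple max-stable process `X`: `θ ∅ = 0` and
`θ A = - τ log P (max_{t ∈ A} X t ≤ τ)` for nonempty finite `A`, whatever `τ > 0`. -/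
def HasECF {T : Type u} {Ω : Type v} [MeasurableSpace Ω]
    (X : T → Ω → ℝ) (P : Measure Ω) (θ : Finset T → ℝ) : Prop :=
  θ ∅ = 0 ∧ ∀ A : Finset T, A.Nonempty → ∀ τ : ℝ, 0 < τ →
    θ A = -τ * Real.log (P.real {ω | ∀ t ∈ A, X t ω ≤ τ})

/-- The set `Θ(T)` of extremal coefficient functions of simple max-stable processes on `T`.
(The path space `T → ℝ` lives in the universe of `T`, so `Ω : Type u` loses no generality.) -/
def ECF (T : Type u) : Set (Finset T → ℝ) :=
  {θ | ∃ (Ω : Type u) (_ : MeasurableSpace Ω) (P : Measure Ω) (X : T → Ω → ℝ),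
    IsProbabilityMeasure P ∧ IsSimpleMaxStable X P ∧ HasECF X P θ}

open Classical in
/-- For `B = {t₁, …, t_k}` with distinct `t_i`, the value `(Δ_{t₁} ⋯ Δ_{t_k} θ) (K)` of the
iterated difference, where `(Δ_t θ) (L) = θ L - θ (L ∪ {t})`. -/
def iteratedDiff {T : Type u} (θ : Finset T → ℝ) (B K : Finset T) : ℝ :=
  ∑ I ∈ B.powerset, (-1 : ℝ) ^ I.card * θ (K ∪ I)

open Classical in
/-- The exponent `- log P (X t ≤ x t, t ∈ A)` of the Tawn-Molchanov finite-dimensional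
distributions:
`∑_{∅ ≠ B ⊆ A} - (Δ_{t₁} ⋯ Δ_{t_k} θ) (A \ B) · max_{j ∈ B} 1 / x j` with `B = {t₁, …, t_k}`. -/
def tmExponent {T : Type u} (θ : Finset T → ℝ) (A : Finset T) (x : T → ℝ) : ℝ :=
  ∑ B ∈ A.powerset,
    if h : B.Nonempty then -iteratedDiff θ B (A \ B) * B.sup' h (fun j => (x j)⁻¹) else 0

/-- Tawn-Molchanov processes: the finite-dimensional distributions are the ones above, for some
`θ` in `Θ(T)`. (They are thereby prescribed on `(0, ∞)^A`, which carries the whole mass.) -/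
def IsTawnMolchanov {T : Type u} {Ω : Type v} [MeasurableSpace Ω]
    (X : T → Ω → ℝ) (P : Measure Ω) : Prop :=
  IsProcess X ∧ ∃ θ ∈ ECF T, ∀ (A : Finset T) (x : T → ℝ), (∀ t ∈ A, 0 < x t) →
    P.real {ω | ∀ t ∈ A, X t ω ≤ x t} = Real.exp (-tmExponent θ A x)

end TailCorrelation

end

namespace TailCorrelation

/-! Dividing joint exceedance probabilities by `P (X t > τ)` and passing to the limit gives `χ (s,
r) + χ (r, t) ≤ 1 + χ (s, t)`: the function `1 - χ` is a pseudometric (`add_le_one_add_of_mem_TCF`).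
Hence `χ` is continuous as soon as `χ (s, t) → 1` for `s → t` (`continuous_of_tendsto_one`), which
settles the equivalence with continuity on the diagonal.

For a simple max-stable process, max-stability makes the limit defining `χ` exact at every level: `P
(X s ≤ τ, X t ≤ τ) = exp (-(2 - χ (s, t)) / τ)` (`IsSimpleMaxStable.pair_law`). So the probability
that a level `τ > 0` separates `X s` from `X t` is a function of `χ (s, t)` that vanishes at `χ (s,
t) = 1`. Stochastic continuity is thereby equivalent to `χ (s, t) → 1`, that is, to continuity of
`χ`.

It remains to realize `χ`. Along an ultrafilter of levels, the normalized probabilities that the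
exceedances on `A` occur exactly on `B` converge to masses `m A B`, consistent in `A`
(`exists_isHittingFamily`). The vectors `max_{B ∋ t} m A B * Z B`, with independent unit Fréchet `Z
B`, have the Tawn-Molchanov laws whose `θ` is the hitting functional of `m`
(`IsHittingFamily.maxLinear_law_of_pos`). These laws are projective, so Kolmogorov extension yields
a process, and `θ {s, t} = 2 - χ (s, t)` identifies its tail correlation function. -/

/-! ### Kolmogorov extension on powers of the line. -/

/-- A finite measure on a finite power of the line is determined by its values on lower orthants. -/
theorem ext_of_lowerOrthants {ι : Type*} [Finite ι] {μ ν : Measure (ι → ℝ)} [IsFiniteMeasure μ]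
    (huniv : μ univ = ν univ) (h : ∀ x : ι → ℝ, μ (Iic x) = ν (Iic x)) : μ = ν := by
  have hspan : IsCountablySpanning (range (Iic : ℝ → Set ℝ)) := by
    refine ⟨fun n : ℕ => Iic (n : ℝ), fun n => ⟨_, rfl⟩, ?_⟩
    refine eq_univ_of_forall fun x => ?_
    obtain ⟨n, hn⟩ := exists_nat_ge x
    exact mem_iUnion.2 ⟨n, hn⟩
  have hgen : (MeasurableSpace.pi : MeasurableSpace (ι → ℝ)) =
      MeasurableSpace.generateFrom (pi univ '' pi univ fun _ => range (Iic : ℝ → Set ℝ)) :=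
    (generateFrom_eq_pi (C := fun _ : ι => range (Iic : ℝ → Set ℝ))
      (fun _ => by rw [← borel_eq_generateFrom_Iic, BorelSpace.measurable_eq (α := ℝ)])
      (fun _ => hspan)).symm
  refine ext_of_generate_finite _ hgen (IsPiSystem.pi fun _ => isPiSystem_Iic) ?_ huniv
  rintro _ ⟨C, hC, rfl⟩
  choose x hx using fun i => hC i (mem_univ i)
  have : C = fun i => Iic (x i) := funext fun i => (hx i).symm
  rw [this, pi_univ_Iic]
  exact h x

/-- A sequence of closed compact cylinders with the finite intersection property has a common
point. -/
theorem nonempty_iInter_cylinder_of_isCompact {ι : Type*} (I : ℕ → Finset ι)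
    (K : ∀ n, Set (I n → ℝ)) (hK : ∀ n, IsCompact (K n))
    (hne : ∀ n, (⋂ i ≤ n, cylinder (α := fun _ : ι => ℝ) (I i) (K i)).Nonempty) :
    (⋂ n, cylinder (α := fun _ : ι => ℝ) (I n) (K n)).Nonempty := by
  choose x hx using hne
  have hmem : ∀ i n, i ≤ n → (I i).restrict (x n) ∈ K i := fun i n hin => by
    have := hx n
    simp only [mem_iInter, mem_cylinder] at this
    exact this i hin
  -- A nonprincipal ultrafilter replaces a diagonal extraction: all coordinates in the sets `I i`
  -- converge along it simultaneously.
  let U : Ultrafilter ℕ := hyperfilter ℕ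
  have hU : (U : Filter ℕ) ≤ atTop := by
    rw [← Nat.cofinite_eq_atTop]; exact hyperfilter_le_cofinite
  have hlim : ∀ i, ∃ y ∈ K i, Tendsto (fun n => (I i).restrict (x n)) U (𝓝 y) := fun i => by
    have hev : ∀ᶠ n in (U : Filter ℕ), (I i).restrict (x n) ∈ K i :=
      hU (eventually_atTop.2 ⟨i, fun n hn => hmem i n hn⟩)
    obtain ⟨y, hy, hle⟩ := (hK i).ultrafilter_le_nhds
      (U.map fun n => (I i).restrict (x n)) (le_principal_iff.2 hev)
    exact ⟨y, hy, hle⟩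
  choose y hy hlim using hlim
  have hcoord : ∀ i (t : I i), Tendsto (fun n => x n t) U (𝓝 (y i t)) := fun i t =>
    (tendsto_pi_nhds.1 (hlim i)) t
  -- Coordinates outside every `I i` may receive a junk limit; no cylinder constrains them.
  refine ⟨fun t => limUnder (U : Filter ℕ) fun n => x n t, mem_iInter.2 fun i => ?_⟩
  rw [mem_cylinder]
  convert hy i using 1
  ext t
  exact (hcoord i t).limUnder_eq

/-- The additive content of a projective family of probability laws on finite powers of the line is
continuous at the empty set. -/
theorem tendsto_projectiveFamilyContent_zero {ι : Type*}
    {P : ∀ J : Finset ι, Measure (J → ℝ)} [∀ J, IsProbabilityMeasure (P J)]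
    (hP : IsProjectiveMeasureFamily (α := fun _ : ι => ℝ) P) {s : ℕ → Set (ι → ℝ)}
    (hs : ∀ n, s n ∈ measurableCylinders fun _ : ι => ℝ) (hanti : Antitone s)
    (hempty : ⋂ n, s n = ∅) :
    Tendsto (fun n => projectiveFamilyContent hP (s n)) atTop (𝓝 0) := by
  have hmono : Antitone fun n => projectiveFamilyContent hP (s n) := fun m n hmn =>
    projectiveFamilyContent_mono hP (hs n) (hs m) (hanti hmn)
  by_contra hcon
  obtain ⟨ε, hε, hle⟩ : ∃ ε : ENNReal, 0 < ε ∧ ∀ n, ε ≤ projectiveFamilyContent hP (s n) := by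
    refine ⟨⨅ n, projectiveFamilyContent hP (s n), ?_, fun n => iInf_le _ n⟩
    rw [pos_iff_ne_zero]
    intro h0
    exact hcon (h0 ▸ tendsto_atTop_iInf hmono)
  choose I S hS hsS using fun n => (mem_measurableCylinders (s n)).1 (hs n)
  -- The total loss in replacing the bases by compact subsets stays below `ε`, so the first `n`
  -- compact cylinders cannot have empty intersection.
  obtain ⟨δ, hδ, hsum⟩ := ENNReal.exists_pos_sum_of_countable' hε.ne' ℕ
  choose K hKS hKc hKδ using fun n =>
    (hS n).exists_isCompact_sdiff_lt (measure_ne_top (P (I n)) _) (hδ n).ne'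
  have hcyl : ∀ n, cylinder (α := fun _ : ι => ℝ) (I n) (K n) ∈ measurableCylinders fun _ : ι => ℝ := fun n =>
    (mem_measurableCylinders _).2 ⟨I n, K n, (hKc n).measurableSet, rfl⟩
  have hne : ∀ n, (⋂ i ≤ n, cylinder (α := fun _ : ι => ℝ) (I i) (K i)).Nonempty := by
    intro n
    by_contra hnone
    rw [not_nonempty_iff_eq_empty] at hnone
    have hsub : s n ⊆ ⋃ i ≤ n, cylinder (α := fun _ : ι => ℝ) (I i) (S i \ K i) := by
      intro z hz
      have : z ∉ ⋂ i ≤ n, cylinder (α := fun _ : ι => ℝ) (I i) (K i) := by rw [hnone]; exact notMem_empty z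
      simp only [mem_iInter, not_forall] at this
      obtain ⟨i, hi, hzi⟩ := this
      have hzs : z ∈ cylinder (α := fun _ : ι => ℝ) (I i) (S i) := hsS i ▸ hanti hi hz
      exact mem_iUnion₂.2 ⟨i, hi, hzs, hzi⟩
    have hdm : ∀ i, cylinder (α := fun _ : ι => ℝ) (I i) (S i \ K i) ∈ measurableCylinders fun _ : ι => ℝ := fun i =>
      (mem_measurableCylinders _).2 ⟨I i, _, (hS i).diff (hKc i).measurableSet, rfl⟩
    have hU : (⋃ i ≤ n, cylinder (α := fun _ : ι => ℝ) (I i) (S i \ K i)) ∈ measurableCylinders fun _ : ι => ℝ := by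
      have := isSetRing_measurableCylinders (α := fun _ : ι => ℝ) |>.biUnion_mem
        (Finset.range (n + 1)) (fun i _ => hdm i)
      simpa only [Finset.mem_range_succ_iff] using this
    have h1 : ε ≤ ∑ i ∈ Finset.range (n + 1), δ i :=
      calc ε ≤ projectiveFamilyContent hP (s n) := hle n
        _ ≤ _ := projectiveFamilyContent_mono hP (hs n) hU hsub
        _ ≤ _ := projectiveFamilyContent_iUnion_le hP hdm n
        _ ≤ _ := Finset.sum_le_sum fun i _ => by
          rw [projectiveFamilyContent_cylinder hP ((hS i).diff (hKc i).measurableSet)]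
          exact (hKδ i).le
    exact absurd (h1.trans (ENNReal.sum_le_tsum _)) (not_le.2 hsum)
  obtain ⟨z, hz⟩ := nonempty_iInter_cylinder_of_isCompact I K hKc hne
  have : z ∈ ⋂ n, s n := mem_iInter.2 fun n => by
    rw [hsS n]
    exact hKS n (mem_iInter.1 hz n)
  rw [hempty] at this
  exact this

/-- **Kolmogorov's extension theorem** for real-valued processes. -/
theorem exists_isProjectiveLimit {ι : Type*}
    {P : ∀ J : Finset ι, Measure (J → ℝ)} [∀ J, IsProbabilityMeasure (P J)]
    (hP : IsProjectiveMeasureFamily (α := fun _ : ι => ℝ) P) : ∃ μ : Measure (ι → ℝ), IsProjectiveLimit (α := fun _ : ι => ℝ) μ P := by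
  have hsub : (projectiveFamilyContent hP).IsSigmaSubadditive := by
    refine isSigmaSubadditive_of_addContent_iUnion_eq_tsum
      isSetRing_measurableCylinders fun f hf hU hd => ?_
    exact addContent_iUnion_eq_sum_of_tendsto_zero isSetRing_measurableCylinders
      (projectiveFamilyContent hP) (fun s _ => projectiveFamilyContent_ne_top hP)
      (fun s hs ha he => tendsto_projectiveFamilyContent_zero hP hs ha he) hf hU hd
  refine ⟨(projectiveFamilyContent hP).measure isSetSemiring_measurableCylinders
    generateFrom_measurableCylinders.ge hsub, fun I => ?_⟩
  ext S hS
  rw [Measure.map_apply (Finset.measurable_restrict I) hS, AddContent.measure_eq, ← cylinder,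
    projectiveFamilyContent_cylinder hP hS]
  · exact generateFrom_measurableCylinders.symm
  · exact cylinder_mem_measurableCylinders _ _ hS

/-! ### The unit Fréchet law. -/

/-- There is a unit Fréchet law on the line. -/
theorem exists_frechet : ∃ ν : Measure ℝ, IsProbabilityMeasure ν ∧
    ∀ x : ℝ, 0 < x → ν.real (Iic x) = Real.exp (-x⁻¹) := by
  have := isProbabilityMeasure_expMeasure (r := 1) one_pos
  have hm : Measurable fun y : ℝ => y⁻¹ := measurable_inv
  have hcdf : ∀ y : ℝ, 0 ≤ y → (expMeasure 1).real (Iic y) = 1 - Real.exp (-y) := fun y hy => by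
    rw [← cdf_eq_real, cdf_expMeasure_eq one_pos, if_pos hy, one_mul]
  have h0 : expMeasure 1 (Iic 0) = 0 := by
    have := hcdf 0 le_rfl
    rw [neg_zero, Real.exp_zero, sub_self, measureReal_eq_zero_iff] at this
    exact this
  refine ⟨(expMeasure 1).map fun y => y⁻¹, Measure.isProbabilityMeasure_map hm.aemeasurable,
    fun x hx => ?_⟩
  rw [map_measureReal_apply hm measurableSet_Iic]
  have hac : expMeasure 1 ≪ volume := withDensity_absolutelyContinuous _ _
  -- The two sets differ only on the null set of `y ≤ 0` and at the atomless point `x⁻¹`.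
  have hpre : (fun y : ℝ => y⁻¹) ⁻¹' Iic x =ᵐ[expMeasure 1] ((Iic x⁻¹)ᶜ : Set ℝ) := by
    have hpos : ∀ᵐ y ∂(expMeasure 1), 0 < y := by
      rw [ae_iff]; simp only [not_lt]; exact h0
    have hne : ∀ᵐ y ∂(expMeasure 1), y ≠ x⁻¹ := by
      rw [ae_iff]; exact hac (by simp)
    filter_upwards [hpos, hne] with y hy hyx
    apply propext
    change y⁻¹ ≤ x ↔ ¬ (y ≤ x⁻¹)
    rw [inv_le_comm₀ hy hx, not_le]
    exact ⟨fun h => lt_of_le_of_ne h (Ne.symm hyx), le_of_lt⟩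
  rw [measureReal_congr hpre, probReal_compl_eq_one_sub measurableSet_Iic,
    hcdf _ (inv_nonneg.2 hx.le)]
  ring

/-! ### Masses, hitting functionals and Möbius inversion. -/

open Classical in
/-- A consistent family of masses: `m A B` is the mass of the sets meeting the finite set `A` exactly
in `B`, under a measure on the nonempty subsets of `T`. -/
structure IsHittingFamily {T : Type u} (m : Finset T → Finset T → ℝ) : Prop where
  nonneg : ∀ A B, 0 ≤ m A B
  proj : ∀ A A' B : Finset T, A' ⊆ A → B ⊆ A' → B.Nonempty →
    m A' B = ∑ C ∈ A.powerset with C ∩ A' = B, m A C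

/-- The hitting functional of a family of masses: the mass of the sets meeting `A`. -/
def hitting {T : Type u} (m : Finset T → Finset T → ℝ) (A : Finset T) : ℝ :=
  ∑ B ∈ A.powerset, m A B * if B.Nonempty then 1 else 0

open Classical in
/-- The largest reciprocal of `x` on `B`, and `0` if `B` is empty. -/
noncomputable def supInv {T : Type u} (x : T → ℝ) (B : Finset T) : ℝ :=
  if h : B.Nonempty then B.sup' h (fun j => (x j)⁻¹) else 0

-- Sets are grouped by their trace on `K`. Consistency says nothing about the empty trace, whence
-- the condition `F ∅ = 0`.
open Classical in
theorem IsHittingFamily.sum_mul {T : Type u} {m : Finset T → Finset T → ℝ}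
    (hm : IsHittingFamily m) {A K : Finset T} (hK : K ⊆ A) {F : Finset T → ℝ} (hF : F ∅ = 0) :
    ∑ B ∈ K.powerset, m K B * F B = ∑ C ∈ A.powerset, m A C * F (C ∩ K) := by
  rw [← Finset.sum_fiberwise_of_maps_to (s := A.powerset) (t := K.powerset) (g := fun C => C ∩ K)
    (fun C _ => Finset.mem_powerset.2 Finset.inter_subset_right)]
  refine Finset.sum_congr rfl fun B hB => ?_
  have hfib : ∑ C ∈ A.powerset with C ∩ K = B, m A C * F (C ∩ K) =
      (∑ C ∈ A.powerset with C ∩ K = B, m A C) * F B := by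
    rw [Finset.sum_mul]
    refine Finset.sum_congr rfl fun C hC => ?_
    rw [(Finset.mem_filter.1 hC).2]
  rw [hfib]
  rcases B.eq_empty_or_nonempty with rfl | hne
  · simp [hF]
  · rw [← hm.proj A K B hK (Finset.mem_powerset.1 hB) hne]

-- `C` misses `A \ B ∪ I` exactly when `C ⊆ B` and `I ⊆ B \ C`. The alternating sum over such `I`
-- vanishes unless `B \ C` is empty.
open Classical in
theorem sum_neg_one_pow_mul_hit {T : Type u} {A B C : Finset T} (hne : B.Nonempty)
    (hC : C ⊆ A) :
    ∑ I ∈ B.powerset, (-1 : ℝ) ^ I.card * (if (C ∩ (A \ B ∪ I)).Nonempty then 1 else 0) =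
      if C = B then -1 else 0 := by
  have alt : ∀ D : Finset T, ∑ I ∈ D.powerset, (-1 : ℝ) ^ I.card = if D = ∅ then 1 else 0 := by
    intro D
    have := congrArg (Int.cast : ℤ → ℝ) (Finset.sum_powerset_neg_one_pow_card (x := D))
    push_cast at this
    exact this
  have hsplit : ∀ I ∈ B.powerset,
      (-1 : ℝ) ^ I.card * (if (C ∩ (A \ B ∪ I)).Nonempty then 1 else 0) =
        (-1 : ℝ) ^ I.card - if C ⊆ B ∧ I ⊆ B \ C then (-1 : ℝ) ^ I.card else 0 := by
    intro I hI
    have hIB := Finset.mem_powerset.1 hI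
    have hiff : (C ∩ (A \ B ∪ I)).Nonempty ↔ ¬ (C ⊆ B ∧ I ⊆ B \ C) := by
      rw [Finset.nonempty_iff_ne_empty, not_iff_not, Finset.eq_empty_iff_forall_notMem]
      simp only [Finset.mem_inter, Finset.mem_union, Finset.mem_sdiff, Finset.subset_iff]
      constructor
      · intro h
        refine ⟨fun x hx => ?_, fun x hx => ⟨hIB hx, fun hxC => h x ⟨hxC, Or.inr hx⟩⟩⟩
        by_contra hxB
        exact h x ⟨hx, Or.inl ⟨hC hx, hxB⟩⟩
      · rintro ⟨h1, h2⟩ x ⟨hxC, hx | hx⟩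
        · exact hx.2 (h1 hxC)
        · exact (h2 hx).2 hxC
    by_cases h : C ⊆ B ∧ I ⊆ B \ C
    · rw [if_pos h, if_neg (by rw [hiff]; exact not_not.2 h)]; ring
    · rw [if_neg h, if_pos (hiff.2 h)]; ring
  rw [Finset.sum_congr rfl hsplit, Finset.sum_sub_distrib, alt, if_neg hne.ne_empty, zero_sub]
  by_cases hCB : C ⊆ B
  · simp only [hCB, true_and]
    rw [← Finset.sum_filter]
    have : (B.powerset.filter fun I => I ⊆ B \ C) = (B \ C).powerset := by
      ext I
      simp only [Finset.mem_filter, Finset.mem_powerset]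
      exact ⟨fun h => h.2, fun h => ⟨h.trans Finset.sdiff_subset, h⟩⟩
    rw [this, alt]
    by_cases hEq : C = B
    · simp [hEq]
    · have : B \ C ≠ ∅ := fun h =>
        hEq (hCB.antisymm (Finset.sdiff_eq_empty_iff_subset.1 h))
      simp [this, hEq]
  · have : C ≠ B := fun h => hCB h.le
    simp [hCB, this]

-- Möbius inversion: up to sign, the coefficients in `tmExponent` are the masses themselves, hence
-- of the right sign to be max-linear weights.
open Classical in
theorem IsHittingFamily.iteratedDiff_hitting {T : Type u} {m : Finset T → Finset T → ℝ}
    (hm : IsHittingFamily m) {A B : Finset T} (hB : B ⊆ A) (hne : B.Nonempty) :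
    iteratedDiff (hitting m) B (A \ B) = -m A B := by
  unfold iteratedDiff
  have h1 : ∀ I ∈ B.powerset, (-1 : ℝ) ^ I.card * hitting m (A \ B ∪ I) =
      ∑ C ∈ A.powerset, m A C *
        ((-1 : ℝ) ^ I.card * if (C ∩ (A \ B ∪ I)).Nonempty then 1 else 0) := by
    intro I hI
    have hsub : A \ B ∪ I ⊆ A :=
      Finset.union_subset Finset.sdiff_subset ((Finset.mem_powerset.1 hI).trans hB)
    rw [hitting, hm.sum_mul hsub (F := fun B => if B.Nonempty then 1 else 0) (by simp),
      Finset.mul_sum]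
    exact Finset.sum_congr rfl fun C _ => by ring
  rw [Finset.sum_congr rfl h1, Finset.sum_comm]
  have h2 : ∀ C ∈ A.powerset, ∑ I ∈ B.powerset, m A C *
      ((-1 : ℝ) ^ I.card * if (C ∩ (A \ B ∪ I)).Nonempty then 1 else 0) =
      if C = B then -m A B else 0 := by
    intro C hC
    rw [← Finset.mul_sum, sum_neg_one_pow_mul_hit hne (Finset.mem_powerset.1 hC)]
    split_ifs with h
    · rw [h]; ring
    · ring
  rw [Finset.sum_congr rfl h2, Finset.sum_ite_eq', if_pos (Finset.mem_powerset.2 hB)]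

open Classical in
theorem IsHittingFamily.tmExponent_hitting {T : Type u} {m : Finset T → Finset T → ℝ}
    (hm : IsHittingFamily m) (A : Finset T) (x : T → ℝ) :
    tmExponent (hitting m) A x = ∑ B ∈ A.powerset, m A B * supInv x B := by
  unfold tmExponent
  refine Finset.sum_congr rfl fun B hB => ?_
  by_cases h : B.Nonempty
  · rw [dif_pos h, hm.iteratedDiff_hitting (Finset.mem_powerset.1 hB) h, supInv, dif_pos h]
    ring
  · rw [dif_neg h, supInv, dif_neg h, mul_zero]

open Classical in
theorem IsHittingFamily.tmExponent_hitting_of_subset {T : Type u} {m : Finset T → Finset T → ℝ}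
    (hm : IsHittingFamily m) {A K : Finset T} (hK : K ⊆ A) (x : T → ℝ) :
    tmExponent (hitting m) K x = ∑ C ∈ A.powerset, m A C * supInv x (C ∩ K) := by
  rw [hm.tmExponent_hitting, hm.sum_mul hK (by simp [supInv])]

/-! ### Tail correlation functions: pseudometric inequality and continuity. -/

theorem upperEndpoint_ne_bot (ν : Measure ℝ) : upperEndpoint ν ≠ ⊥ := by
  obtain ⟨x, hx⟩ := ((tendsto_cdf_atBot ν).eventually (gt_mem_nhds one_pos)).exists
  have : (x : EReal) ≤ upperEndpoint ν := le_sSup ⟨x, hx, rfl⟩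
  exact fun h => EReal.coe_ne_bot x (le_bot_iff.1 (h ▸ this))

theorem toUpperEndpoint_neBot (ν : Measure ℝ) : (toUpperEndpoint ν).NeBot := by
  refine comap_neBot fun s hs => ?_
  obtain ⟨l, hl, hsub⟩ :=
    (mem_nhdsLT_iff_exists_Ioo_subset' (bot_lt_iff_ne_bot.2 (upperEndpoint_ne_bot ν))).1 hs
  obtain ⟨q, hq1, hq2⟩ := EReal.lt_iff_exists_real_btwn.1 hl
  exact ⟨q, hsub ⟨hq1, hq2⟩⟩

theorem eventually_cdf_lt_one (ν : Measure ℝ) : ∀ᶠ x in toUpperEndpoint ν, cdf ν x < 1 := by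
  refine (eventually_comap.2 ?_)
  filter_upwards [self_mem_nhdsWithin] with y hy x hxy
  obtain ⟨_, ⟨z, hz, rfl⟩, hlt⟩ := lt_sSup_iff.1 (show y < upperEndpoint ν from hy)
  rw [← hxy, EReal.coe_lt_coe_iff] at hlt
  exact (monotone_cdf ν hlt.le).trans_lt hz

theorem cond_real_setOf {Ω : Type v} [MeasurableSpace Ω] (P : Measure Ω) {Y Z : Ω → ℝ}
    (hZ : Measurable Z) (τ : ℝ) :
    (cond P {ω | τ < Z ω}).real {ω | τ < Y ω} =
      P.real ({ω | τ < Y ω} ∩ {ω | τ < Z ω}) / P.real {ω | τ < Z ω} := by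
  rw [Measure.real, cond_apply (measurableSet_lt measurable_const hZ), ENNReal.toReal_mul,
    ENNReal.toReal_inv, inter_comm, mul_comm, ← div_eq_mul_inv]
  rfl

/-- A tail correlation function is a limit of normalized probabilities of joint exceedances. -/
theorem exists_exceedances_of_mem_TCF {T : Type u} [Nonempty T] {χ : T × T → ℝ}
    (hχ : χ ∈ TCF.{u, v} T) :
    ∃ (Ω : Type v) (_ : MeasurableSpace Ω) (P : Measure Ω) (X : T → Ω → ℝ) (p : ℝ → ℝ)
      (U : Ultrafilter ℝ), IsProbabilityMeasure P ∧ IsProcess X ∧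
      (∀ t τ, P.real {ω | τ < X t ω} = p τ) ∧ (∀ᶠ τ in (U : Filter ℝ), 0 < p τ) ∧
      ∀ s t, Tendsto (fun τ => P.real ({ω | τ < X s ω} ∩ {ω | τ < X t ω}) / p τ) U
        (𝓝 (χ (s, t))) := by
  obtain ⟨Ω, mΩ, P, X, hP, hX, hid, hlim⟩ := hχ
  let t₀ : T := Classical.arbitrary T
  have : IsProbabilityMeasure (P.map (X t₀)) := Measure.isProbabilityMeasure_map (hX t₀).aemeasurable
  have hp : ∀ t τ, P.real {ω | τ < X t ω} = (P.map (X t₀)).real (Ioi τ) := fun t τ => by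
    rw [← hid t t₀, map_measureReal_apply (hX t) measurableSet_Ioi]; rfl
  have hne := toUpperEndpoint_neBot (P.map (X t₀))
  -- An ultrafilter is used so that further bounded ratios, whose limits are not assumed, also
  -- converge.
  let U := Ultrafilter.of (toUpperEndpoint (P.map (X t₀)))
  have hU : (U : Filter ℝ) ≤ toUpperEndpoint (P.map (X t₀)) := Ultrafilter.of_le _
  refine ⟨Ω, mΩ, P, X, fun τ => (P.map (X t₀)).real (Ioi τ), U, hP, hX, hp, ?_, fun s t => ?_⟩
  · filter_upwards [hU (eventually_cdf_lt_one (P.map (X t₀)))] with τ hτ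
    rw [← compl_Iic, probReal_compl_eq_one_sub measurableSet_Iic, ← cdf_eq_real]
    linarith
  · have h := (hlim s t)
    rw [hid t t₀] at h
    refine (h.mono_left hU).congr fun τ => ?_
    rw [cond_real_setOf P (hX t), hp]

/-- With `E` the exceedance events, `E s ∩ E r` and `E r ∩ E t` have union inside `E r` and
intersection inside `E s ∩ E t`. -/
theorem add_le_one_add_of_mem_TCF {T : Type u} {χ : T × T → ℝ} (hχ : χ ∈ TCF.{u, v} T)
    (s r t : T) : χ (s, r) + χ (r, t) ≤ 1 + χ (s, t) := by
  have : Nonempty T := ⟨s⟩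
  obtain ⟨Ω, mΩ, P, X, p, U, hP, hX, hp, hpos, hlim⟩ := exists_exceedances_of_mem_TCF hχ
  refine le_of_tendsto_of_tendsto ((hlim s r).add (hlim r t))
    (tendsto_const_nhds.add (hlim s t)) ?_
  filter_upwards [hpos] with τ hτ
  have hmeas : ∀ t, MeasurableSet {ω | τ < X t ω} := fun t =>
    measurableSet_lt measurable_const (hX t)
  rw [← add_div, ← div_self hτ.ne', ← add_div, div_le_div_iff_of_pos_right hτ,
    ← measureReal_union_add_inter ((hmeas r).inter (hmeas t))]
  refine add_le_add ?_ (measureReal_mono fun ω hω => ⟨hω.1.1, hω.2.2⟩)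
  rw [← hp r τ]
  refine measureReal_mono fun ω hω => ?_
  rcases hω with hω | hω
  · exact hω.2
  · exact hω.1

theorem symm_of_mem_TCF {T : Type u} {χ : T × T → ℝ} (hχ : χ ∈ TCF.{u, v} T) (s t : T) :
    χ (s, t) = χ (t, s) := by
  have : Nonempty T := ⟨s⟩
  obtain ⟨Ω, mΩ, P, X, p, U, hP, hX, hp, hpos, hlim⟩ := exists_exceedances_of_mem_TCF hχ
  refine tendsto_nhds_unique (hlim s t) ((hlim t s).congr fun τ => ?_)
  rw [inter_comm]

theorem apply_self_of_mem_TCF {T : Type u} {χ : T × T → ℝ} (hχ : χ ∈ TCF.{u, v} T) (t : T) :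
    χ (t, t) = 1 := by
  have : Nonempty T := ⟨t⟩
  obtain ⟨Ω, mΩ, P, X, p, U, hP, hX, hp, hpos, hlim⟩ := exists_exceedances_of_mem_TCF hχ
  refine tendsto_nhds_unique (hlim t t) (tendsto_const_nhds.congr' ?_)
  filter_upwards [hpos] with τ hτ
  rw [inter_self, hp, div_self hτ.ne']

/-- The pseudometric inequality gives `|χ (s, t) - χ (s₀, t₀)| ≤ (1 - χ (s, s₀)) + (1 - χ (t, t₀))`.
-/
theorem continuous_of_tendsto_one {T : Type u} [TopologicalSpace T] {χ : T × T → ℝ}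
    (hχ : χ ∈ TCF.{u, v} T) (h : ∀ t, Tendsto (fun s => χ (s, t)) (𝓝 t) (𝓝 1)) :
    Continuous χ := by
  rw [continuous_iff_continuousAt]
  rintro ⟨s₀, t₀⟩
  have htri := add_le_one_add_of_mem_TCF hχ
  have hsym := symm_of_mem_TCF hχ
  have hb : Tendsto (fun z : T × T => 2 - χ (z.1, s₀) - χ (z.2, t₀)) (𝓝 (s₀, t₀)) (𝓝 0) := by
    have h1 := (h s₀).comp (continuous_fst.tendsto (s₀, t₀))
    have h2 := (h t₀).comp (continuous_snd.tendsto (s₀, t₀))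
    have := (h1.const_sub 2).sub h2
    norm_num at this
    exact this
  rw [ContinuousAt, tendsto_iff_dist_tendsto_zero]
  refine squeeze_zero (fun _ => dist_nonneg) (fun z => ?_) hb
  obtain ⟨s, t⟩ := z
  rw [Real.dist_eq, abs_le]
  have e1 := htri s s₀ t
  have e2 := htri s₀ t₀ t
  have e3 := htri s₀ s t₀
  have e4 := htri s t t₀
  rw [hsym t₀ t] at e2
  rw [hsym s₀ s] at e3
  dsimp only
  constructor <;> linarith

theorem continuous_iff_tendsto_one {T : Type u} [TopologicalSpace T] {χ : T × T → ℝ}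
    (hχ : χ ∈ TCF.{u, v} T) :
    Continuous χ ↔ ∀ t, Tendsto (fun s => χ (s, t)) (𝓝 t) (𝓝 1) := by
  refine ⟨fun h t => ?_, continuous_of_tendsto_one hχ⟩
  have : Continuous fun s => χ (s, t) := h.comp (by fun_prop)
  simpa only [apply_self_of_mem_TCF hχ t] using this.tendsto t

/-! ### Masses as limits of exceedance patterns. -/

-- An event depending only on which `E t`, `t ∈ A`, occur is a disjoint union of exact patterns.
open Classical in
theorem measureReal_setOf_forall_iff {T : Type u} {Ω : Type v} [MeasurableSpace Ω] (P : Measure Ω)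
    [IsProbabilityMeasure P] {E : T → Set Ω} (hE : ∀ t, MeasurableSet (E t)) (A : Finset T)
    {S : Set Ω} (Q : Finset T → Prop) [DecidablePred Q]
    (hS : ∀ ω, ω ∈ S ↔ Q (A.filter fun t => ω ∈ E t)) :
    P.real S = ∑ C ∈ A.powerset with Q C, P.real {ω | ∀ t ∈ A, ω ∈ E t ↔ t ∈ C} := by
  have hkey : ∀ (ω : Ω) (C : Finset T), C ⊆ A → (∀ t ∈ A, ω ∈ E t ↔ t ∈ C) →
      A.filter (fun t => ω ∈ E t) = C := fun ω C hC h => by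
    ext t
    rw [Finset.mem_filter]
    exact ⟨fun ht => (h t ht.1).1 ht.2, fun ht => ⟨hC ht, (h t (hC ht)).2 ht⟩⟩
  rw [← measureReal_biUnion_finset]
  · congr 1
    ext ω
    rw [hS]
    simp only [mem_iUnion, Finset.mem_filter, Finset.mem_powerset, mem_ofPred_eq, exists_prop]
    constructor
    · intro h
      exact ⟨_, ⟨Finset.filter_subset _ _, h⟩, fun t ht => by simp [ht]⟩
    · rintro ⟨C, ⟨hC, hQ⟩, h⟩
      rwa [hkey ω C hC h]
  · intro C hC D hD hne
    refine Set.disjoint_left.2 fun ω hω hω' => hne ?_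
    simp only [Finset.coe_filter, Finset.mem_powerset, mem_ofPred_eq] at hC hD
    rw [← hkey ω C hC.1 hω, hkey ω D hD.1 hω']
  · intro C _
    have : {ω | ∀ t ∈ A, ω ∈ E t ↔ t ∈ C} =
        ⋂ t ∈ A, if t ∈ C then E t else (E t)ᶜ := by
      ext ω
      simp only [mem_ofPred_eq, mem_iInter]
      refine forall₂_congr fun t _ => ?_
      split_ifs with h <;> simp [h]
    rw [this]
    refine Finset.measurableSet_biInter _ fun t _ => ?_
    split_ifs
    · exact hE t
    · exact (hE t).compl

open Classical in
/-- The tail correlation function determines the pair values of the hitting functional of some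
family of masses. -/
theorem exists_isHittingFamily {T : Type u} {χ : T × T → ℝ} (hχ : χ ∈ TCF.{u, v} T) :
    ∃ m : Finset T → Finset T → ℝ, IsHittingFamily m ∧
      ∀ s t, hitting m {s, t} = 2 - χ (s, t) := by
  rcases isEmpty_or_nonempty T with hT | hT
  · refine ⟨0, ⟨fun _ _ => le_rfl, fun _ _ _ _ _ ⟨b, _⟩ => isEmptyElim b⟩, fun s => isEmptyElim s⟩
  obtain ⟨Ω, mΩ, P, X, p, U, hP, hX, hp, hpos, hlim⟩ := exists_exceedances_of_mem_TCF hχ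
  let E : ℝ → T → Set Ω := fun τ t => {ω | τ < X t ω}
  have hE : ∀ τ t, MeasurableSet (E τ t) := fun τ t => measurableSet_lt measurable_const (hX t)
  -- For nonempty `B ⊆ A` the pattern lies in a single exceedance event, so the ratio is at most
  -- `1`. For `B = ∅` it could be unbounded, so it is set to `0`.
  let q : Finset T → Finset T → ℝ → ℝ := fun A B τ =>
    if B.Nonempty ∧ B ⊆ A then P.real {ω | ∀ t ∈ A, ω ∈ E τ t ↔ t ∈ B} / p τ else 0
  have hp0 : ∀ τ, 0 ≤ p τ := fun τ => hp (Classical.arbitrary T) τ ▸ measureReal_nonneg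
  have hq : ∀ A B τ, q A B τ ∈ Icc (0 : ℝ) 1 := by
    intro A B τ
    simp only [q]
    split_ifs with h
    · refine ⟨div_nonneg measureReal_nonneg (hp0 τ), div_le_one_of_le₀ ?_ (hp0 τ)⟩
      obtain ⟨⟨b, hb⟩, hBA⟩ := h
      rw [← hp b τ]
      exact measureReal_mono fun ω hω => (hω b (hBA hb)).2 hb
    · exact ⟨le_rfl, zero_le_one⟩
  have hconv : ∀ A B, ∃ y ∈ Icc (0 : ℝ) 1, Tendsto (q A B) U (𝓝 y) := fun A B =>
    isCompact_Icc.ultrafilter_le_nhds (U.map (q A B))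
      (le_principal_iff.2 (Filter.Eventually.of_forall (p := fun τ => q A B τ ∈ Icc (0 : ℝ) 1) (hq A B)))
  choose m hm hmlim using hconv
  refine ⟨m, ⟨fun A B => (hm A B).1, fun A A' B hA' hB hne => ?_⟩, fun s t => ?_⟩
  · refine tendsto_nhds_unique (hmlim A' B)
      ((tendsto_finsetSum _ fun C _ => hmlim A C).congr fun τ => ?_)
    simp only [q]
    rw [if_pos ⟨hne, hB⟩, measureReal_setOf_forall_iff P (hE τ) A (fun C => C ∩ A' = B),
      Finset.sum_div]
    · refine Finset.sum_congr rfl fun C hC => ?_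
      obtain ⟨hCA, hCB⟩ := Finset.mem_filter.1 hC
      rw [if_pos ⟨hne.mono (hCB ▸ Finset.inter_subset_left), Finset.mem_powerset.1 hCA⟩]
    · intro ω
      rw [Finset.ext_iff, mem_ofPred_eq]
      constructor
      · intro h t
        simp only [Finset.mem_inter, Finset.mem_filter]
        exact ⟨fun ht => (h t ht.2).1 ht.1.2,
          fun ht => ⟨⟨hA' (hB ht), (h t (hB ht)).2 ht⟩, hB ht⟩⟩
      · intro h t ht
        rw [← h t]
        simp [ht, hA' ht]
  · have h1 : Tendsto (fun τ => P.real (E τ s ∪ E τ t) / p τ) U (𝓝 (hitting m {s, t})) := by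
      refine (tendsto_finsetSum _ fun B _ => (hmlim {s, t} B).mul_const _).congr fun τ => ?_
      rw [measureReal_setOf_forall_iff P (hE τ) {s, t} (fun C => C.Nonempty), Finset.sum_div,
        Finset.sum_filter]
      · refine Finset.sum_congr rfl fun C hC => ?_
        simp only [q]
        by_cases h : C.Nonempty
        · rw [if_pos ⟨h, Finset.mem_powerset.1 hC⟩, if_pos h, if_pos h, mul_one]
        · rw [if_neg h, if_neg h, mul_zero]
      · intro ω
        simp [Finset.filter_nonempty_iff]
    refine tendsto_nhds_unique h1 (((hlim s t).const_sub 2).congr' ?_)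
    filter_upwards [hpos] with τ hτ
    have h2 := measureReal_union_add_inter (μ := P) (s := E τ s) (hE τ t)
    have hps : P.real (E τ s) = p τ := hp s τ
    have hpt : P.real (E τ t) = p τ := hp t τ
    rw [hps, hpt] at h2
    rw [eq_div_iff hτ.ne', sub_mul, div_mul_cancel₀ _ hτ.ne']
    change 2 * p τ - P.real (E τ s ∩ E τ t) = _
    linarith

/-! ### Realization by max-linear Fréchet vectors. -/

/-- The law is prescribed only at positive levels; `exp (-1 / y) → 0` as `y ↓ 0` excludes mass on
the rest. -/
theorem measureReal_setOf_le_nonpos {Ω : Type v} [MeasurableSpace Ω] {P : Measure Ω}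
    [IsProbabilityMeasure P] {Y : Ω → ℝ}
    (hY : ∀ x : ℝ, 0 < x → P.real {ω | Y ω ≤ x} = Real.exp (-1 / x)) {x : ℝ} (hx : x ≤ 0) :
    P.real {ω | Y ω ≤ x} = 0 := by
  refine le_antisymm ?_ measureReal_nonneg
  have hlim : Tendsto (fun y : ℝ => Real.exp (-1 / y)) (𝓝[>] 0) (𝓝 0) := by
    refine Real.tendsto_exp_atBot.comp ?_
    have := tendsto_neg_atTop_atBot.comp (tendsto_inv_nhdsGT_zero (𝕜 := ℝ))
    refine this.congr fun y => ?_
    simp [neg_div]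
  refine ge_of_tendsto hlim ?_
  filter_upwards [self_mem_nhdsWithin] with y hy
  rw [← hY y hy]
  exact measureReal_mono fun ω hω => (le_trans hω hx).trans (le_of_lt hy)

open Classical in
theorem tmExponent_singleton {T : Type u} (θ : Finset T → ℝ) (t : T) (x : T → ℝ) :
    tmExponent θ {t} x = (θ {t} - θ ∅) * (x t)⁻¹ := by
  unfold tmExponent iteratedDiff
  have hps : ({t} : Finset T).powerset = {∅, {t}} := by
    ext B; simp [Finset.subset_singleton_iff]
  rw [hps, Finset.sum_insert (by simp), Finset.sum_singleton,
    dif_neg Finset.not_nonempty_empty, dif_pos (Finset.singleton_nonempty t), zero_add,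
    Finset.sup'_singleton, hps,
    Finset.sum_insert (by simp), Finset.sum_singleton]
  simp only [Finset.card_empty, Finset.card_singleton, Finset.sdiff_self,
    Finset.empty_union, Finset.union_empty]
  ring

theorem supInv_of_mem {T : Type u} {x : T → ℝ} {D : Finset T} (hD : D.Nonempty)
    (hx : ∀ t ∈ D, 0 < x t) :
    ∃ t₀ ∈ D, supInv x D = (x t₀)⁻¹ ∧ ∀ t ∈ D, x t₀ ≤ x t := by
  obtain ⟨t₀, ht₀, heq⟩ := D.exists_mem_eq_sup' hD fun j => (x j)⁻¹
  refine ⟨t₀, ht₀, by rw [supInv, dif_pos hD, heq], fun t ht => ?_⟩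
  have h := Finset.le_sup' (fun j => (x j)⁻¹) ht
  rw [heq] at h
  exact (inv_le_inv₀ (hx t ht) (hx t₀ ht₀)).1 h

theorem frechet_setOf_forall_mul_le {T : Type u} {ν : Measure ℝ} [IsProbabilityMeasure ν]
    (hν : ∀ x : ℝ, 0 < x → ν.real (Iic x) = Real.exp (-x⁻¹)) {c : ℝ} (hc : 0 ≤ c) {x : T → ℝ}
    {D : Finset T} (hx : ∀ t ∈ D, 0 < x t) :
    ν.real {y | ∀ t ∈ D, c * y ≤ x t} = Real.exp (-(c * supInv x D)) := by
  rcases D.eq_empty_or_nonempty with rfl | hD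
  · simp [supInv]
  rcases hc.eq_or_lt with rfl | hc
  · have : {y : ℝ | ∀ t ∈ D, 0 * y ≤ x t} = univ :=
      eq_univ_of_forall fun y t ht => by rw [zero_mul]; exact (hx t ht).le
    rw [this]; simp
  obtain ⟨t₀, ht₀, heq, hmin⟩ := supInv_of_mem hD hx
  have : {y : ℝ | ∀ t ∈ D, c * y ≤ x t} = Iic (x t₀ / c) := by
    ext y
    rw [mem_Iic, le_div_iff₀' hc]
    exact ⟨fun h => h t₀ ht₀, fun h t ht => le_trans h (hmin t ht)⟩
  rw [this, hν _ (div_pos (hx t₀ ht₀) hc), heq, inv_div, div_eq_mul_inv]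

open Classical in
theorem filter_mem_powerset_nonempty {T : Type u} (A : Finset T) (t : A) :
    (A.powerset.filter fun B => (t : T) ∈ B).Nonempty :=
  ⟨A, Finset.mem_filter.2 ⟨Finset.mem_powerset_self A, t.2⟩⟩

open Classical in
/-- The max-linear vector on `A` with coefficients `m A B`, driven by the variables `z B`. -/
noncomputable def maxLinear {T : Type u} (m : Finset T → Finset T → ℝ) (A : Finset T)
    (z : Finset T → ℝ) (t : A) : ℝ :=
  (A.powerset.filter fun B => (t : T) ∈ B).sup' (filter_mem_powerset_nonempty A t)
    fun B => m A B * z B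

theorem measurable_maxLinear {T : Type u} (m : Finset T → Finset T → ℝ) (A : Finset T) :
    Measurable (maxLinear m A) := by
  refine measurable_pi_lambda _ fun t => ?_
  have : (fun z => maxLinear m A z t) = (Finset.sup' _ (filter_mem_powerset_nonempty A t)
      fun B (z : Finset T → ℝ) => m A B * z B) := by
    ext z
    rw [maxLinear, Finset.sup'_apply]
  rw [this]
  exact Finset.measurable_sup' _ fun B _ => (measurable_pi_apply B).const_mul _

-- The constraints decouple over `B`: each asks `m A B * z B ≤ x t` for all `t ∈ B ∩ K`.
-- Independence then turns the sum in the exponent into a product.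
open Classical in
theorem IsHittingFamily.maxLinear_law_of_pos {T : Type u} {m : Finset T → Finset T → ℝ}
    (hm : IsHittingFamily m) {ν : Measure ℝ} [IsProbabilityMeasure ν]
    (hν : ∀ x : ℝ, 0 < x → ν.real (Iic x) = Real.exp (-x⁻¹)) {A K : Finset T} (hK : K ⊆ A)
    {x : T → ℝ} (hx : ∀ t ∈ K, 0 < x t) :
    (Measure.infinitePi fun _ : Finset T => ν).real
      {z | ∀ t (ht : t ∈ K), maxLinear m A z ⟨t, hK ht⟩ ≤ x t} =
      Real.exp (-tmExponent (hitting m) K x) := by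
  have hset : {z : Finset T → ℝ | ∀ t (ht : t ∈ K), maxLinear m A z ⟨t, hK ht⟩ ≤ x t} =
      Set.pi (A.powerset : Set (Finset T)) fun B => {y | ∀ t ∈ B ∩ K, m A B * y ≤ x t} := by
    ext z
    simp only [maxLinear, Finset.sup'_le_iff, mem_ofPred_eq, Set.mem_pi, Finset.mem_coe,
      Finset.mem_filter, Finset.mem_inter]
    exact ⟨fun h B hB t ht => h t ht.2 B ⟨hB, ht.1⟩, fun h t ht B hB => h B hB.1 t ⟨hB.2, ht⟩⟩
  have hmeas : ∀ B : Finset T, MeasurableSet {y : ℝ | ∀ t ∈ B ∩ K, m A B * y ≤ x t} := fun B => by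
    have : {y : ℝ | ∀ t ∈ B ∩ K, m A B * y ≤ x t} = ⋂ t ∈ B ∩ K, {y : ℝ | m A B * y ≤ x t} := by
      ext y; simp only [mem_ofPred_eq, mem_iInter]
    rw [this]
    exact Finset.measurableSet_biInter _ fun t _ =>
      measurableSet_le (measurable_id.const_mul _) measurable_const
  rw [hset, Measure.real, Measure.infinitePi_pi _ fun B _ => hmeas B, ENNReal.toReal_prod,
    hm.tmExponent_hitting_of_subset hK, ← Finset.sum_neg_distrib, Real.exp_sum]
  refine Finset.prod_congr rfl fun B _ => ?_
  exact frechet_setOf_forall_mul_le hν (hm.nonneg A B) fun t ht => hx t (Finset.mem_inter.1 ht).2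

-- All real `x` are covered, as needed to compare measures on orthants. The right side does not
-- involve `A`, which is projectivity.
open Classical in
theorem IsHittingFamily.maxLinear_law {T : Type u} {m : Finset T → Finset T → ℝ}
    (hm : IsHittingFamily m) (h1 : ∀ t, hitting m {t} = 1) {ν : Measure ℝ} [IsProbabilityMeasure ν]
    (hν : ∀ x : ℝ, 0 < x → ν.real (Iic x) = Real.exp (-x⁻¹)) {A K : Finset T} (hK : K ⊆ A)
    (x : T → ℝ) :
    (Measure.infinitePi fun _ : Finset T => ν).real
      {z | ∀ t (ht : t ∈ K), maxLinear m A z ⟨t, hK ht⟩ ≤ x t} =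
      if ∀ t ∈ K, 0 < x t then Real.exp (-tmExponent (hitting m) K x) else 0 := by
  split_ifs with hx
  · exact hm.maxLinear_law_of_pos hν hK hx
  · push Not at hx
    obtain ⟨t, ht, hxt⟩ := hx
    have hmargin : ∀ y : ℝ, 0 < y → (Measure.infinitePi fun _ : Finset T => ν).real
        {z | maxLinear m A z ⟨t, hK ht⟩ ≤ y} = Real.exp (-1 / y) := fun y hy => by
      have := hm.maxLinear_law_of_pos hν (Finset.singleton_subset_iff.2 (hK ht))
        (x := fun _ => y) fun _ _ => hy
      rw [tmExponent_singleton, h1] at this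
      have hset : {z | maxLinear m A z ⟨t, hK ht⟩ ≤ y} = {z | ∀ s (hs : s ∈ ({t} : Finset T)),
          maxLinear m A z ⟨s, Finset.singleton_subset_iff.2 (hK ht) hs⟩ ≤ y} := by
        ext z
        refine ⟨fun h s hs => ?_, fun h => h t (Finset.mem_singleton_self t)⟩
        obtain rfl := Finset.mem_singleton.1 hs
        exact h
      rw [hset, this]
      congr 1
      simp [hitting, neg_div]
    refine le_antisymm ?_ measureReal_nonneg
    rw [← measureReal_setOf_le_nonpos hmargin hxt]
    exact measureReal_mono fun z hz => hz t ht

/-- Every normalized consistent family of masses is realized by a process with the corresponding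
Tawn-Molchanov finite-dimensional distributions. -/
theorem IsHittingFamily.exists_process {T : Type u} {m : Finset T → Finset T → ℝ}
    (hm : IsHittingFamily m) (h1 : ∀ t, hitting m {t} = 1) :
    ∃ (Ω : Type u) (_ : MeasurableSpace Ω) (P : Measure Ω) (X : T → Ω → ℝ),
      IsProbabilityMeasure P ∧ IsProcess X ∧
      ∀ (A : Finset T) (x : T → ℝ), (∀ t ∈ A, 0 < x t) →
        P.real {ω | ∀ t ∈ A, X t ω ≤ x t} = Real.exp (-tmExponent (hitting m) A x) := by
  classical
  obtain ⟨ν, hνp, hν⟩ := exists_frechet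
  let Q : Measure (Finset T → ℝ) := Measure.infinitePi fun _ : Finset T => ν
  let L : ∀ J : Finset T, Measure (J → ℝ) := fun J => Q.map (maxLinear m J)
  have hL : ∀ J, IsProbabilityMeasure (L J) := fun J =>
    Measure.isProbabilityMeasure_map (measurable_maxLinear m J).aemeasurable
  have hproj : IsProjectiveMeasureFamily (α := fun _ : T => ℝ) L := by
    intro A K hK
    have hr : Measurable (Finset.restrict₂ (π := fun _ : T => ℝ) hK) :=
      Finset.measurable_restrict₂ hK
    have := Measure.isProbabilityMeasure_map (μ := L A) hr.aemeasurable
    refine ext_of_lowerOrthants (by simp) fun x => ?_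
    let x' : T → ℝ := fun t => if h : t ∈ K then x ⟨t, h⟩ else 1
    rw [Measure.map_apply hr measurableSet_Iic,
      Measure.map_apply (measurable_maxLinear m K) measurableSet_Iic,
      Measure.map_apply (measurable_maxLinear m A) (hr measurableSet_Iic),
      ← measureReal_eq_measureReal_iff]
    have e1 := hm.maxLinear_law h1 hν (Finset.Subset.refl K) x'
    rw [← hm.maxLinear_law h1 hν hK x'] at e1
    convert e1 using 2
    · ext z
      simp only [mem_preimage, mem_Iic, Pi.le_def, Subtype.forall, mem_ofPred_eq]
      refine forall₂_congr fun t ht => ?_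
      simp [x', ht]
    · ext z
      simp only [mem_preimage, mem_Iic, Pi.le_def, Subtype.forall, mem_ofPred_eq]
      refine forall₂_congr fun t ht => ?_
      simp [x', ht, Finset.restrict₂]
  obtain ⟨μ, hμ⟩ := exists_isProjectiveLimit hproj
  have hμp : IsProbabilityMeasure μ := hμ.isProbabilityMeasure
  refine ⟨T → ℝ, inferInstance, μ, fun t ω => ω t, hμp, fun t => measurable_pi_apply t,
    fun A x hx => ?_⟩
  rw [← hm.maxLinear_law_of_pos hν (Finset.Subset.refl A) hx]
  have hS : MeasurableSet (Iic fun t : A => x t) := measurableSet_Iic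
  have e := congrArg (fun κ => κ (Iic fun t : A => x t)) (hμ A)
  simp only [L] at e
  rw [Measure.map_apply (Finset.measurable_restrict A) hS,
    Measure.map_apply (measurable_maxLinear m A) hS] at e
  have e' := congrArg ENNReal.toReal e
  convert e' using 2
  · congr 1
    ext ω
    simp [Pi.le_def]
  · congr 1
    ext z
    simp [Pi.le_def]

/-! ### Fréchet margins and max-stability. -/

theorem hasIdenticalMargins_of_frechet {T : Type u} {Ω : Type v} [MeasurableSpace Ω]
    {P : Measure Ω} [IsProbabilityMeasure P] {X : T → Ω → ℝ} (hX : IsProcess X)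
    (hF : ∀ t, ∀ x : ℝ, 0 < x → P.real {ω | X t ω ≤ x} = Real.exp (-1 / x)) :
    HasIdenticalMargins X P := by
  intro s t
  have hs := Measure.isProbabilityMeasure_map (μ := P) (hX s).aemeasurable
  have ht := Measure.isProbabilityMeasure_map (μ := P) (hX t).aemeasurable
  refine Measure.ext_of_Iic _ _ fun x => ?_
  rw [Measure.map_apply (hX s) measurableSet_Iic, Measure.map_apply (hX t) measurableSet_Iic,
    ← measureReal_eq_measureReal_iff]
  change P.real {ω | X s ω ≤ x} = P.real {ω | X t ω ≤ x}
  rcases le_or_gt x 0 with hx | hx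
  · rw [measureReal_setOf_le_nonpos (hF s) hx, measureReal_setOf_le_nonpos (hF t) hx]
  · rw [hF s x hx, hF t x hx]

theorem toUpperEndpoint_map_of_frechet {Ω : Type v} [MeasurableSpace Ω]
    {P : Measure Ω} [IsProbabilityMeasure P] {Y : Ω → ℝ} (hY : Measurable Y)
    (hF : ∀ x : ℝ, 0 < x → P.real {ω | Y ω ≤ x} = Real.exp (-1 / x)) :
    toUpperEndpoint (P.map Y) = atTop := by
  have := Measure.isProbabilityMeasure_map (μ := P) hY.aemeasurable
  have hlt : ∀ x : ℝ, cdf (P.map Y) x < 1 := fun x => by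
    have h1 : (0 : ℝ) < max x 1 := lt_max_of_lt_right one_pos
    refine (monotone_cdf _ (le_max_left x 1)).trans_lt ?_
    rw [cdf_eq_real, map_measureReal_apply hY measurableSet_Iic]
    change P.real {ω | Y ω ≤ max x 1} < 1
    rw [hF _ h1, Real.exp_lt_one_iff]
    exact div_neg_of_neg_of_pos (by norm_num) h1
  have htop : upperEndpoint (P.map Y) = ⊤ := by
    rw [EReal.eq_top_iff_forall_lt]
    intro y
    exact lt_of_lt_of_le (EReal.coe_lt_coe_iff.2 (lt_add_one y)) (le_sSup ⟨y + 1, hlt _, rfl⟩)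
  have hIio : (Iio ⊤ : Set EReal) = {⊤}ᶜ := by ext x; simp [lt_top_iff_ne_top]
  rw [toUpperEndpoint, htop, hIio, EReal.nhdsWithin_top, comap_map EReal.coe_injective]

theorem pi_real_setOf_iSup_le {T : Type u} {Ω : Type v} [MeasurableSpace Ω]
    {P : Measure Ω} [IsProbabilityMeasure P] {X : T → Ω → ℝ} {n : ℕ} (hn : 0 < n) (A : Finset T)
    (x : A → ℝ) :
    (Measure.pi fun _ : Fin n => P).real {ω | ∀ t : A, ⨆ i : Fin n, X t (ω i) ≤ x t} =
      P.real {ω | ∀ t : A, X t ω ≤ x t} ^ n := by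
  have : Nonempty (Fin n) := ⟨⟨0, hn⟩⟩
  have hset : {ω : Fin n → Ω | ∀ t : A, ⨆ i : Fin n, X t (ω i) ≤ x t} =
      Set.pi univ fun _ => {ω | ∀ t : A, X t ω ≤ x t} := by
    ext ω
    simp only [mem_ofPred_eq, Set.mem_pi, mem_univ, true_imp_iff]
    exact ⟨fun h i t => (le_ciSup (finite_range _).bddAbove i).trans (h t),
      fun h t => ciSup_le fun i => h i t⟩
  rw [hset, Measure.real, Measure.pi_pi]
  simp [Measure.real]

theorem measurable_pi_iSup {T : Type u} {Ω : Type v} [MeasurableSpace Ω] {X : T → Ω → ℝ}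
    (hX : IsProcess X) (n : ℕ) (A : Finset T) :
    Measurable fun (ω : Fin n → Ω) (t : A) => ⨆ i : Fin n, X t (ω i) :=
  measurable_pi_lambda _ fun t => Measurable.iSup fun i => (hX t).comp (measurable_pi_apply i)

theorem measurable_pi_const_mul {T : Type u} {Ω : Type v} [MeasurableSpace Ω] {X : T → Ω → ℝ}
    (hX : IsProcess X) (c : ℝ) (A : Finset T) :
    Measurable fun (ω : Ω) (t : A) => c * X t ω :=
  measurable_pi_lambda _ fun t => (hX t).const_mul c

theorem supInv_div {T : Type u} (x : T → ℝ) {c : ℝ} (hc : 0 < c) (B : Finset T) :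
    supInv (fun t => x t / c) B = c * supInv x B := by
  classical
  unfold supInv
  split_ifs with h
  · rw [Finset.mul₀_sup' hc.le]
    exact Finset.sup'_congr h rfl fun j _ => by rw [inv_div, div_eq_mul_inv]
  · rw [mul_zero]

open Classical in
theorem tmExponent_eq_sum_supInv {T : Type u} (θ : Finset T → ℝ) (A : Finset T) (x : T → ℝ) :
    tmExponent θ A x = ∑ B ∈ A.powerset, -iteratedDiff θ B (A \ B) * supInv x B := by
  unfold tmExponent supInv
  refine Finset.sum_congr rfl fun B _ => ?_
  split_ifs
  · rfl
  · rw [mul_zero]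

/-- Homogeneity of degree `-1` is the analytic form of max-stability. -/
theorem tmExponent_div {T : Type u} (θ : Finset T → ℝ) (A : Finset T) (x : T → ℝ) {c : ℝ}
    (hc : 0 < c) : tmExponent θ A (fun t => x t / c) = c * tmExponent θ A x := by
  rw [tmExponent_eq_sum_supInv, tmExponent_eq_sum_supInv, Finset.mul_sum]
  exact Finset.sum_congr rfl fun B _ => by rw [supInv_div x hc]; ring

/-- A process with Tawn-Molchanov finite-dimensional distributions is simple max-stable. -/
theorem isSimpleMaxStable_of_law {T : Type u} {Ω : Type v} [MeasurableSpace Ω]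
    {P : Measure Ω} [IsProbabilityMeasure P] {X : T → Ω → ℝ} (hX : IsProcess X)
    {θ : Finset T → ℝ} (h0 : θ ∅ = 0) (h1 : ∀ t, θ {t} = 1)
    (hlaw : ∀ (A : Finset T) (x : T → ℝ), (∀ t ∈ A, 0 < x t) →
      P.real {ω | ∀ t ∈ A, X t ω ≤ x t} = Real.exp (-tmExponent θ A x)) :
    IsSimpleMaxStable X P := by
  classical
  have hF : ∀ t, ∀ x : ℝ, 0 < x → P.real {ω | X t ω ≤ x} = Real.exp (-1 / x) := fun t x hx => by
    have := hlaw {t} (fun _ => x) fun _ _ => hx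
    rw [tmExponent_singleton, h0, h1] at this
    simp only [Finset.mem_singleton, forall_eq, sub_zero, one_mul] at this
    rw [this, neg_div, one_div]
  refine ⟨hX, hF, fun n hn A => ?_⟩
  have hn' : (0 : ℝ) < n := Nat.cast_pos.2 hn
  have hm1 := measurable_pi_iSup hX n A
  have hm2 := measurable_pi_const_mul hX (n : ℝ) A
  have i1 := Measure.isProbabilityMeasure_map (μ := Measure.pi fun _ : Fin n => P) hm1.aemeasurable
  have i2 := Measure.isProbabilityMeasure_map (μ := P) hm2.aemeasurable
  refine ext_of_lowerOrthants (by simp) fun x => ?_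
  rw [Measure.map_apply hm1 measurableSet_Iic, Measure.map_apply hm2 measurableSet_Iic,
    ← measureReal_eq_measureReal_iff]
  change (Measure.pi fun _ : Fin n => P).real {ω | ∀ t : A, ⨆ i : Fin n, X t (ω i) ≤ x t} =
    P.real {ω | ∀ t : A, n * X t ω ≤ x t}
  rw [pi_real_setOf_iSup_le hn]
  by_cases hx : ∀ t, 0 < x t
  · let x' : T → ℝ := fun t => if h : t ∈ A then x ⟨t, h⟩ else 1
    have hx' : ∀ t ∈ A, 0 < x' t := fun t ht => by simp only [x', dif_pos ht]; exact hx _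
    have e1 : {ω | ∀ t : A, X t ω ≤ x t} = {ω | ∀ t ∈ A, X t ω ≤ x' t} := by
      ext ω
      simp only [mem_ofPred_eq, Subtype.forall]
      exact forall₂_congr fun t ht => by simp [x', ht]
    have e2 : {ω | ∀ t : A, n * X t ω ≤ x t} = {ω | ∀ t ∈ A, X t ω ≤ x' t / n} := by
      ext ω
      simp only [mem_ofPred_eq, Subtype.forall]
      exact forall₂_congr fun t ht => by rw [le_div_iff₀' hn']; simp [x', ht]
    rw [e1, e2, hlaw A x' hx', hlaw A _ fun t ht => div_pos (hx' t ht) hn',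
      tmExponent_div θ A x' hn', ← Real.exp_nat_mul]
    congr 1; ring
  · push Not at hx
    obtain ⟨t, ht⟩ := hx
    have hz := measureReal_setOf_le_nonpos (hF t) le_rfl
    have z1 : P.real {ω | ∀ t : A, X t ω ≤ x t} = 0 := le_antisymm
      (hz ▸ measureReal_mono fun ω hω => (hω t).trans ht) measureReal_nonneg
    have z2 : P.real {ω | ∀ t : A, n * X t ω ≤ x t} = 0 := le_antisymm
      (hz ▸ measureReal_mono fun ω hω => nonpos_of_mul_nonpos_right ((hω t).trans ht) hn')
      measureReal_nonneg
    rw [z1, z2, zero_pow hn.ne']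

theorem IsSimpleMaxStable.hasECF_singleton {T : Type u} {Ω : Type v} [MeasurableSpace Ω]
    {P : Measure Ω} {X : T → Ω → ℝ} (hX : IsSimpleMaxStable X P) {θ : Finset T → ℝ}
    (hθ : HasECF X P θ) (t : T) : θ {t} = 1 := by
  have h := hθ.2 {t} (Finset.singleton_nonempty t) 1 one_pos
  simp only [Finset.mem_singleton, forall_eq] at h
  rw [h, hX.frechet t 1 one_pos, Real.log_exp]
  norm_num

/-- Tawn-Molchanov processes are simple max-stable. -/
theorem IsTawnMolchanov.isSimpleMaxStable {T : Type u} {Ω : Type v} [MeasurableSpace Ω]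
    {P : Measure Ω} [IsProbabilityMeasure P] {X : T → Ω → ℝ} (hX : IsTawnMolchanov X P) :
    IsSimpleMaxStable X P := by
  obtain ⟨hpr, θ, ⟨Ω', _, P', X', _, hX', hθ⟩, hlaw⟩ := hX
  exact isSimpleMaxStable_of_law hpr hθ.1 (hX'.hasECF_singleton hθ) hlaw

theorem IsHittingFamily.tmExponent_hitting_const {T : Type u} {m : Finset T → Finset T → ℝ}
    (hm : IsHittingFamily m) (A : Finset T) (τ : ℝ) :
    tmExponent (hitting m) A (fun _ => τ) = hitting m A * τ⁻¹ := by
  rw [hm.tmExponent_hitting, hitting, Finset.sum_mul]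
  refine Finset.sum_congr rfl fun B _ => ?_
  unfold supInv
  split_ifs with h
  · rw [Finset.sup'_const, mul_one]
  · simp

/-- This is the derivative of `1 - exp (-c * y)` at `0`, read along `y = x⁻¹`. -/
theorem tendsto_mul_one_sub_exp_neg_div (c : ℝ) :
    Tendsto (fun x : ℝ => x * (1 - Real.exp (-c / x))) atTop (𝓝 c) := by
  have hd : HasDerivAt (fun y : ℝ => 1 - Real.exp (-c * y)) c 0 := by
    have h1 : HasDerivAt (fun y : ℝ => -c * y) (-c) 0 := by
      simpa using (hasDerivAt_id (0 : ℝ)).const_mul (-c)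
    have := h1.exp.const_sub 1
    simpa using this
  have h := (hasDerivAt_iff_tendsto_slope.1 hd).comp
    ((tendsto_inv_atTop_nhdsGT_zero (𝕜 := ℝ)).mono_right
      (nhdsWithin_mono 0 fun y (hy : 0 < y) => hy.ne'))
  refine h.congr fun x => ?_
  simp [slope, div_eq_mul_inv]

theorem tendsto_one_sub_exp_neg_div_div (c : ℝ) :
    Tendsto (fun x : ℝ => (1 - Real.exp (-c / x)) / (1 - Real.exp (-1 / x))) atTop (𝓝 c) := by
  have h := (tendsto_mul_one_sub_exp_neg_div c).div (tendsto_mul_one_sub_exp_neg_div 1) one_ne_zero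
  rw [div_one] at h
  refine h.congr' ?_
  filter_upwards [eventually_gt_atTop 0] with x hx
  exact mul_div_mul_left _ _ hx.ne'

/-! ### Bivariate laws and stochastic continuity of simple max-stable processes. -/

section Pairs

variable {T : Type u} {Ω : Type v} [MeasurableSpace Ω] {P : Measure Ω} [IsProbabilityMeasure P]
  {X : T → Ω → ℝ}

/-- The conditional exceedance probability in terms of the bivariate distribution function. -/
theorem IsSimpleMaxStable.cond_real_eq (hX : IsSimpleMaxStable X P) (s t : T) {τ : ℝ}
    (hτ : 0 < τ) :
    (cond P {ω | τ < X t ω}).real {ω | τ < X s ω} =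
      2 - (1 - P.real {ω | X s ω ≤ τ ∧ X t ω ≤ τ}) / (1 - Real.exp (-1 / τ)) := by
  have hm : ∀ r, MeasurableSet {ω | X r ω ≤ τ} := fun r =>
    measurableSet_le (hX.isProcess r) measurable_const
  have hc : ∀ r, {ω | τ < X r ω} = {ω | X r ω ≤ τ}ᶜ := fun r => by ext ω; simp
  have hpos : 0 < 1 - Real.exp (-1 / τ) := by
    rw [sub_pos, Real.exp_lt_one_iff]
    exact div_neg_of_neg_of_pos (by norm_num) hτ
  have hu := measureReal_union_add_inter (μ := P) (s := {ω | X s ω ≤ τ}) (hm t)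
  rw [hX.frechet s τ hτ, hX.frechet t τ hτ] at hu
  rw [cond_real_setOf P (hX.isProcess t), hc s, hc t, ← compl_union,
    probReal_compl_eq_one_sub ((hm s).union (hm t)), probReal_compl_eq_one_sub (hm t),
    hX.frechet t τ hτ, eq_sub_iff_add_eq, ← add_div, div_eq_iff hpos.ne']
  have hi : P.real ({ω | X s ω ≤ τ} ∩ {ω | X t ω ≤ τ}) =
      P.real {ω | X s ω ≤ τ ∧ X t ω ≤ τ} := rfl
  rw [hi] at hu
  linarith

theorem IsSimpleMaxStable.toUpperEndpoint_eq (hX : IsSimpleMaxStable X P) (t : T) :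
    toUpperEndpoint (P.map (X t)) = atTop :=
  toUpperEndpoint_map_of_frechet (hX.isProcess t) (hX.frechet t)

theorem IsSimpleMaxStable.hasTCF_of_pairs (hX : IsSimpleMaxStable X P) {χ : T × T → ℝ}
    (h : ∀ s t, ∀ τ : ℝ, 0 < τ →
      P.real {ω | X s ω ≤ τ ∧ X t ω ≤ τ} = Real.exp (-(2 - χ (s, t)) / τ)) :
    HasTCF X P χ := by
  refine ⟨hasIdenticalMargins_of_frechet hX.isProcess hX.frechet, fun s t => ?_⟩
  rw [hX.toUpperEndpoint_eq]
  have hlim := (tendsto_one_sub_exp_neg_div_div (2 - χ (s, t))).const_sub 2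
  rw [sub_sub_cancel] at hlim
  refine hlim.congr' ?_
  filter_upwards [eventually_gt_atTop 0] with τ hτ
  rw [hX.cond_real_eq s t hτ, h s t τ hτ]

theorem IsSimpleMaxStable.pair_pow (hX : IsSimpleMaxStable X P) (s t : T) {n : ℕ} (hn : 0 < n)
    (τ : ℝ) :
    P.real {ω | X s ω ≤ n * τ ∧ X t ω ≤ n * τ} ^ n = P.real {ω | X s ω ≤ τ ∧ X t ω ≤ τ} := by
  classical
  have hn' : (0 : ℝ) < n := Nat.cast_pos.2 hn
  have e := congrArg (fun κ => (κ (Iic fun _ => n * τ)).toReal) (hX.maxStable n hn {s, t})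
  rw [Measure.map_apply (measurable_pi_iSup hX.isProcess n _) measurableSet_Iic,
    Measure.map_apply (measurable_pi_const_mul hX.isProcess _ _) measurableSet_Iic] at e
  have e' := (pi_real_setOf_iSup_le (P := P) (X := X) hn {s, t} fun _ => n * τ).symm.trans e
  convert e' using 2
  · congr 1
    ext ω
    simp
  · congr 1
    ext ω
    simp [Pi.le_def, hn']

/-- The bivariate diagonal distributions of a simple max-stable process are determined by its
tail correlation function. -/
theorem IsSimpleMaxStable.pair_law (hX : IsSimpleMaxStable X P) {χ : T × T → ℝ}
    (hχ : HasTCF X P χ) (s t : T) {τ : ℝ} (hτ : 0 < τ) :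
    P.real {ω | X s ω ≤ τ ∧ X t ω ≤ τ} = Real.exp (-(2 - χ (s, t)) / τ) := by
  set g := P.real {ω | X s ω ≤ τ ∧ X t ω ≤ τ} with hg
  let G : ℕ → ℝ := fun n => P.real {ω | X s ω ≤ n * τ ∧ X t ω ≤ n * τ}
  have hscale : Tendsto (fun n : ℕ => (n : ℝ) * τ) atTop atTop :=
    tendsto_natCast_atTop_atTop.atTop_mul_const hτ
  have hlim := (hχ.2 s t)
  rw [hX.toUpperEndpoint_eq] at hlim
  have h1 : Tendsto (fun n : ℕ => (1 - G n) / (1 - Real.exp (-1 / (n * τ)))) atTop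
      (𝓝 (2 - χ (s, t))) := by
    refine ((hlim.comp hscale).const_sub 2).congr' ?_
    filter_upwards [eventually_gt_atTop 0] with n hn
    rw [Function.comp_apply, hX.cond_real_eq s t (mul_pos (Nat.cast_pos.2 hn) hτ)]
    ring
  have hden : Tendsto (fun n : ℕ => 1 - Real.exp (-1 / ((n : ℝ) * τ))) atTop (𝓝 0) := by
    have : Tendsto (fun x : ℝ => 1 - Real.exp (-1 / x)) atTop (𝓝 0) := by
      have := (Real.continuous_exp.tendsto 0).comp (tendsto_const_nhds.div_atTop tendsto_id :
        Tendsto (fun x : ℝ => -1 / x) atTop (𝓝 0))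
      simpa [Function.comp_def] using this.const_sub 1
    exact this.comp hscale
  -- The ratio in `h1` converges while its denominator tends to `0`, so `G n → 1`. Some `G n` with
  -- `n > 0` is then positive, and `g = G n ^ n`.
  have hpos : 0 < g := by
    have h2 : Tendsto (fun n => 1 - G n) atTop (𝓝 0) := by
      have := h1.mul hden
      rw [mul_zero] at this
      refine this.congr' ?_
      filter_upwards [eventually_gt_atTop 0] with n hn
      refine div_mul_cancel₀ _ (sub_pos.2 ?_).ne'
      rw [Real.exp_lt_one_iff]
      exact div_neg_of_neg_of_pos (by norm_num) (mul_pos (Nat.cast_pos.2 hn) hτ)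
    obtain ⟨n, hn1, hn0⟩ :=
      ((h2.eventually (gt_mem_nhds one_pos)).and (eventually_gt_atTop 0)).exists
    rw [hg, ← hX.pair_pow s t hn0 τ]
    exact pow_pos (by simp only [G] at hn1; linarith) n
  -- `G n` is the `n`-th root of `g`, written so that the limit of the ratio is visibly the extremal
  -- coefficient `-τ * log g`.
  have hG : ∀ n : ℕ, 0 < n → G n = Real.exp (-(-τ * Real.log g) / (n * τ)) := fun n hn => by
    have hn' : (n : ℝ) ≠ 0 := (Nat.cast_pos.2 hn).ne'
    refine (pow_left_inj₀ measureReal_nonneg (Real.exp_pos _).le hn.ne').1 ?_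
    rw [hX.pair_pow s t hn τ, ← hg, ← Real.exp_nat_mul]
    have : (n : ℝ) * (-(-τ * Real.log g) / (n * τ)) = Real.log g := by
      field_simp
    rw [this, Real.exp_log hpos]
  have h3 : Tendsto (fun n : ℕ => (1 - G n) / (1 - Real.exp (-1 / (n * τ)))) atTop
      (𝓝 (-τ * Real.log g)) := by
    refine ((tendsto_one_sub_exp_neg_div_div (-τ * Real.log g)).comp hscale).congr' ?_
    filter_upwards [eventually_gt_atTop 0] with n hn
    rw [Function.comp_apply, hG n hn]
  have heq := tendsto_nhds_unique h1 h3
  rw [heq]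
  have : -(-τ * Real.log g) / τ = Real.log g := by field_simp
  rw [this, Real.exp_log hpos]

theorem IsSimpleMaxStable.measureReal_le_lt (hX : IsSimpleMaxStable X P) {χ : T × T → ℝ}
    (hχ : HasTCF X P χ) (s t : T) {τ : ℝ} (hτ : 0 < τ) :
    P.real {ω | X s ω ≤ τ ∧ τ < X t ω} =
      Real.exp (-1 / τ) - Real.exp (-(2 - χ (s, t)) / τ) := by
  have h := measureReal_inter_add_sdiff (μ := P) (s := {ω | X s ω ≤ τ})
    (t := {ω | X t ω ≤ τ}) (measurableSet_le (hX.isProcess t) measurable_const)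
  rw [hX.frechet s τ hτ] at h
  have e1 : {ω | X s ω ≤ τ} ∩ {ω | X t ω ≤ τ} = {ω | X s ω ≤ τ ∧ X t ω ≤ τ} := rfl
  have e2 : {ω | X s ω ≤ τ} \ {ω | X t ω ≤ τ} = {ω | X s ω ≤ τ ∧ τ < X t ω} := by
    ext ω; simp
  rw [e1, e2, hX.pair_law hχ s t hτ] at h
  linarith

/-- The single level `1` suffices, since the probability that it separates `X t` from `X s`
determines `χ (t, s)`. -/
theorem IsSimpleMaxStable.tendsto_one_of_stochasticallyContinuous [TopologicalSpace T]
    (hX : IsSimpleMaxStable X P) {χ : T × T → ℝ} (hχ : HasTCF X P χ)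
    (hsc : StochasticallyContinuous X P) (t : T) :
    Tendsto (fun s => χ (s, t)) (𝓝 t) (𝓝 1) := by
  have hprob := tendstoInMeasure_iff_measureReal_dist.1 (hsc t)
  have hz : Tendsto (fun s => P.real {ω | X t ω ≤ 1 ∧ 1 < X s ω}) (𝓝 t) (𝓝 0) := by
    rw [tendsto_order]
    refine ⟨fun a ha => Eventually.of_forall fun s => ha.trans_le measureReal_nonneg,
      fun δ hδ => ?_⟩
    have hcont : Tendsto (fun y : ℝ => Real.exp (-1 / 1) - Real.exp (-1 / y)) (𝓝[<] 1) (𝓝 0) := by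
      have : ContinuousAt (fun y : ℝ => Real.exp (-1 / 1) - Real.exp (-1 / y)) 1 := by
        fun_prop (disch := norm_num)
      have h := this.tendsto
      rw [sub_self] at h
      exact h.mono_left nhdsWithin_le_nhds
    obtain ⟨y, hyδ, hy1, hy0⟩ := ((hcont.eventually (gt_mem_nhds (half_pos hδ))).and
      (eventually_mem_nhdsWithin.and (nhdsWithin_le_nhds (lt_mem_nhds one_pos)))).exists
    have hy1' : y < 1 := hy1
    filter_upwards [(hprob (1 - y) (sub_pos.2 hy1')).eventually (gt_mem_nhds (half_pos hδ))]
      with s hs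
    -- Either the jump exceeds `1 - y`, or `X t` lies in `(y, 1]`, an event made small by choosing
    -- `y` close to `1`.
    have hsub : {ω | X t ω ≤ 1 ∧ 1 < X s ω} ⊆
        {ω | 1 - y ≤ dist (X s ω) (X t ω)} ∪ ({ω | X t ω ≤ 1} \ {ω | X t ω ≤ y}) := by
      rintro ω ⟨h1, h2⟩
      by_cases hω : X t ω ≤ y
      · left
        change 1 - y ≤ dist (X s ω) (X t ω)
        rw [Real.dist_eq]
        exact le_trans (by linarith) (le_abs_self _)
      · exact Or.inr ⟨h1, hω⟩
    have hd : P.real ({ω | X t ω ≤ 1} \ {ω | X t ω ≤ y}) =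
        Real.exp (-1 / 1) - Real.exp (-1 / y) := by
      have hle : {ω | X t ω ≤ y} ⊆ {ω | X t ω ≤ 1} := fun ω (hω : X t ω ≤ y) =>
        show X t ω ≤ 1 from hω.trans hy1'.le
      rw [measureReal_sdiff hle (measurableSet_le (hX.isProcess t) measurable_const), hX.frechet t 1 one_pos,
        hX.frechet t y hy0]
    calc _ ≤ _ := measureReal_mono hsub
      _ ≤ _ := measureReal_union_le _ _
      _ < δ := by rw [hd]; linarith
  have hG : Tendsto (fun s => Real.exp (-(2 - χ (t, s)) / 1)) (𝓝 t) (𝓝 (Real.exp (-1 / 1))) := by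
    have := hz.const_sub (Real.exp (-1 / 1))
    rw [sub_zero] at this
    refine this.congr fun s => ?_
    rw [hX.measureReal_le_lt hχ t s one_pos]
    ring
  have hlog := (hG.log (Real.exp_pos _).ne').const_add 2
  simp only [Real.log_exp] at hlog
  norm_num at hlog
  have hsym : ∀ s, χ (t, s) = χ (s, t) := fun s => by
    have h1 := hX.pair_law hχ t s one_pos
    have h2 := hX.pair_law hχ s t one_pos
    have e : {ω | X t ω ≤ 1 ∧ X s ω ≤ 1} = {ω | X s ω ≤ 1 ∧ X t ω ≤ 1} := by
      ext ω; exact and_comm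
    rw [e, h2] at h1
    have := Real.exp_injective h1
    linarith
  exact hlog.congr hsym

theorem exists_grid_point {ε a b : ℝ} (hε : 0 < ε) (ha : 0 < a) (hab : ε ≤ b - a) {N : ℕ}
    (hN : a ≤ N * ε) :
    ∃ k ∈ Finset.Icc 1 N, a ≤ k * ε ∧ k * ε < b := by
  refine ⟨⌈a / ε⌉₊, Finset.mem_Icc.2 ⟨Nat.one_le_iff_ne_zero.2 ?_, Nat.ceil_le.2 ?_⟩, ?_, ?_⟩
  · exact (Nat.ceil_pos.2 (div_pos ha hε)).ne'
  · rwa [div_le_iff₀ hε]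
  · rw [← div_le_iff₀ hε]; exact Nat.le_ceil _
  · have := Nat.ceil_lt_add_one (div_pos ha hε).le
    rw [← sub_lt_iff_lt_add, lt_div_iff₀ hε] at this
    nlinarith

/-- If `X s` and `X t` are positive, at distance at least `ε`, and `X t ≤ N * ε`, then some grid
level `k * ε` with `1 ≤ k ≤ N` separates them. For fixed `N` these finitely many separation
probabilities tend to `0`. Truncating `X t` alone is enough, because the smaller of the two values
never exceeds it. -/
theorem IsSimpleMaxStable.stochasticallyContinuous_of_tendsto_one [TopologicalSpace T]
    (hX : IsSimpleMaxStable X P) {χ : T × T → ℝ} (hχ : HasTCF X P χ)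
    (h : ∀ t, Tendsto (fun s => χ (s, t)) (𝓝 t) (𝓝 1))
    (hsym : ∀ s t, χ (s, t) = χ (t, s)) : StochasticallyContinuous X P := by
  intro t
  rw [tendstoInMeasure_iff_measureReal_dist]
  intro ε hε
  rw [tendsto_order]
  refine ⟨fun a ha => Eventually.of_forall fun s => ha.trans_le measureReal_nonneg,
    fun δ hδ => ?_⟩
  have htail : Tendsto (fun N : ℕ => 1 - Real.exp (-1 / (N * ε))) atTop (𝓝 0) := by
    have h1 : Tendsto (fun N : ℕ => (N : ℝ) * ε) atTop atTop :=
      tendsto_natCast_atTop_atTop.atTop_mul_const hε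
    have := (Real.continuous_exp.tendsto 0).comp (tendsto_const_nhds.div_atTop h1 :
      Tendsto (fun N : ℕ => -1 / ((N : ℝ) * ε)) atTop (𝓝 0))
    simpa [Function.comp_def] using this.const_sub 1
  obtain ⟨N, hNδ, hN⟩ := ((htail.eventually (gt_mem_nhds (half_pos hδ))).and
    (eventually_gt_atTop 0)).exists
  have hNε : 0 < (N : ℝ) * ε := mul_pos (Nat.cast_pos.2 hN) hε
  let D : ℝ → T → ℝ := fun x s => Real.exp (-1 / x) - Real.exp (-(2 - χ (s, t)) / x)
  have hD : ∀ x, Tendsto (D x) (𝓝 t) (𝓝 0) := fun x => by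
    have := (((h t).const_sub 2).neg.div_const x).rexp.const_sub (Real.exp (-1 / x))
    norm_num at this
    simpa [D] using this
  have hsum : Tendsto (fun s => ∑ k ∈ Finset.Icc 1 N, (D (k * ε) s + D (k * ε) s)) (𝓝 t)
      (𝓝 0) := by
    have := tendsto_finsetSum (Finset.Icc 1 N) fun k _ => (hD (k * ε)).add (hD (k * ε))
    simpa using this
  filter_upwards [hsum.eventually (gt_mem_nhds (half_pos hδ))] with s hs
  let B : ℕ → Set Ω := fun k => {ω | X s ω ≤ k * ε ∧ k * ε < X t ω} ∪
    {ω | X t ω ≤ k * ε ∧ k * ε < X s ω}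
  have hsub : {ω | ε ≤ dist (X s ω) (X t ω)} ⊆
      (({ω | X s ω ≤ 0} ∪ {ω | X t ω ≤ 0}) ∪ {ω | X t ω ≤ N * ε}ᶜ) ∪
        ⋃ k ∈ Finset.Icc 1 N, B k := by
    intro ω hω
    by_contra hcon
    simp only [mem_union, not_or, mem_ofPred_eq, not_le, mem_compl_iff, mem_iUnion,
      not_exists] at hcon
    obtain ⟨⟨⟨hs0, ht0⟩, htN⟩, hk⟩ := hcon
    rw [not_lt] at htN
    have hω' : ε ≤ |X s ω - X t ω| := hω
    rcases le_abs.1 hω' with hst | hst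
    · obtain ⟨k, hkN, h1, h2⟩ := exists_grid_point hε ht0 hst htN
      exact hk k hkN (Or.inr ⟨h1, h2⟩)
    · have hst' : ε ≤ X t ω - X s ω := by linarith
      obtain ⟨k, hkN, h1, h2⟩ := exists_grid_point hε hs0 hst' (N := N) (by linarith)
      exact hk k hkN (Or.inl ⟨h1, h2⟩)
  have hBk : ∀ k ∈ Finset.Icc 1 N, P.real (B k) ≤ D (k * ε) s + D (k * ε) s := fun k hk => by
    have hkε : 0 < (k : ℝ) * ε := mul_pos (Nat.cast_pos.2 (Finset.mem_Icc.1 hk).1) hε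
    refine (measureReal_union_le _ _).trans (le_of_eq ?_)
    rw [hX.measureReal_le_lt hχ s t hkε, hX.measureReal_le_lt hχ t s hkε, hsym t s]
  have hA : P.real (({ω | X s ω ≤ 0} ∪ {ω | X t ω ≤ 0}) ∪ {ω | X t ω ≤ N * ε}ᶜ) < δ / 2 := by
    refine (measureReal_union_le _ _).trans_lt ?_
    rw [probReal_compl_eq_one_sub (measurableSet_le (hX.isProcess t) measurable_const),
      hX.frechet t _ hNε]
    have := measureReal_union_le (μ := P) {ω | X s ω ≤ 0} {ω | X t ω ≤ 0}
    rw [measureReal_setOf_le_nonpos (hX.frechet s) le_rfl,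
      measureReal_setOf_le_nonpos (hX.frechet t) le_rfl] at this
    linarith
  calc _ ≤ _ := measureReal_mono hsub
    _ ≤ _ := measureReal_union_le _ _
    _ ≤ _ := add_le_add le_rfl (measureReal_biUnion_finset_le _ _)
    _ ≤ _ := add_le_add le_rfl (Finset.sum_le_sum hBk)
    _ < δ := by linarith

end Pairs

/-! ### Equivalences and the main theorem. -/

theorem IsSimpleMaxStable.stochasticallyContinuous_iff {T : Type u} [TopologicalSpace T]
    {Ω : Type w} [MeasurableSpace Ω] {P : Measure Ω} [IsProbabilityMeasure P] {X : T → Ω → ℝ}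
    (hX : IsSimpleMaxStable X P) {χ : T × T → ℝ} (hT : HasTCF X P χ) (hχ : χ ∈ TCF.{u, v} T) :
    StochasticallyContinuous X P ↔ Continuous χ := by
  rw [continuous_iff_tendsto_one hχ]
  exact ⟨hX.tendsto_one_of_stochasticallyContinuous hT, fun h =>
    hX.stochasticallyContinuous_of_tendsto_one hT h (symm_of_mem_TCF hχ)⟩

theorem continuous_iff_continuousAt_diagonal {T : Type u} [TopologicalSpace T] {χ : T × T → ℝ}
    (hχ : χ ∈ TCF.{u, v} T) : Continuous χ ↔ ∀ t, ContinuousAt χ (t, t) := by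
  refine ⟨fun h t => h.continuousAt, fun h => continuous_of_tendsto_one hχ fun t => ?_⟩
  have hc : Continuous fun s : T => (s, t) := by fun_prop
  have := (h t).tendsto.comp (hc.tendsto t)
  rwa [apply_self_of_mem_TCF hχ t] at this

/-- Every tail correlation function is realized by a Tawn-Molchanov process. -/
theorem exists_isTawnMolchanov {T : Type u} {χ : T × T → ℝ} (hχ : χ ∈ TCF.{u, v} T) :
    ∃ (Ω : Type u) (_ : MeasurableSpace Ω) (P : Measure Ω) (X : T → Ω → ℝ),
      IsProbabilityMeasure P ∧ IsTawnMolchanov X P ∧ HasTCF X P χ := by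
  classical
  obtain ⟨m, hm, hpair⟩ := exists_isHittingFamily hχ
  have h1 : ∀ t, hitting m {t} = 1 := fun t => by
    have := hpair t t
    rw [Finset.pair_eq_singleton, apply_self_of_mem_TCF hχ] at this
    rw [this]; norm_num
  have h0 : hitting m ∅ = 0 := by simp [hitting]
  obtain ⟨Ω, mΩ, P, X, hP, hX, hlaw⟩ := hm.exists_process h1
  have hmax := isSimpleMaxStable_of_law hX h0 h1 hlaw
  have hconst : ∀ (A : Finset T) (τ : ℝ), 0 < τ →
      P.real {ω | ∀ t ∈ A, X t ω ≤ τ} = Real.exp (-(hitting m A * τ⁻¹)) := fun A τ hτ => by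
    rw [hlaw A (fun _ => τ) fun _ _ => hτ, hm.tmExponent_hitting_const]
  have hecf : HasECF X P (hitting m) := ⟨h0, fun A _ τ hτ => by
    rw [hconst A τ hτ, Real.log_exp]
    field_simp⟩
  refine ⟨Ω, mΩ, P, X, hP, ⟨hX, hitting m, ⟨Ω, mΩ, P, X, hP, hmax, hecf⟩, hlaw⟩,
    hmax.hasTCF_of_pairs fun s t τ hτ => ?_⟩
  rw [← hpair s t, neg_div, div_eq_mul_inv]
  convert hconst {s, t} τ hτ using 2
  congr 1
  ext ω
  simp

end TailCorrelation

theorem mainTheorem4 {T : Type u} [TopologicalSpace T] (χ : T × T → ℝ)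
    (hχ : χ ∈ TailCorrelation.TCF.{u, v} T) :
    List.TFAE [
      Continuous χ,
      ∀ t : T, ContinuousAt χ (t, t),
      ∃ (Ω : Type u) (_ : MeasurableSpace Ω) (P : MeasureTheory.Measure Ω) (X : T → Ω → ℝ),
        MeasureTheory.IsProbabilityMeasure P ∧ TailCorrelation.IsSimpleMaxStable X P ∧
          TailCorrelation.StochasticallyContinuous X P ∧ TailCorrelation.HasTCF X P χ,
      ∃ (Ω : Type u) (_ : MeasurableSpace Ω) (P : MeasureTheory.Measure Ω) (X : T → Ω → ℝ),
        MeasureTheory.IsProbabilityMeasure P ∧ TailCorrelation.IsTawnMolchanov X P ∧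
          TailCorrelation.StochasticallyContinuous X P ∧ TailCorrelation.HasTCF X P χ] ∧
    (∃ (Ω : Type u) (_ : MeasurableSpace Ω) (P : MeasureTheory.Measure Ω) (X : T → Ω → ℝ),
      MeasureTheory.IsProbabilityMeasure P ∧ TailCorrelation.IsTawnMolchanov X P ∧
        TailCorrelation.HasTCF X P χ) ∧
    ∀ (Ω : Type w) (_ : MeasurableSpace Ω) (P : MeasureTheory.Measure Ω) (X : T → Ω → ℝ),
      MeasureTheory.IsProbabilityMeasure P → TailCorrelation.IsTawnMolchanov X P →
        TailCorrelation.HasTCF X P χ →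
          (TailCorrelation.StochasticallyContinuous X P ↔ Continuous χ) := by
  have hTM := TailCorrelation.exists_isTawnMolchanov hχ
  refine ⟨?_, hTM, fun Ω _ P X _ hX hT =>
    hX.isSimpleMaxStable.stochasticallyContinuous_iff hT hχ⟩
  tfae_have 1 ↔ 2 := TailCorrelation.continuous_iff_continuousAt_diagonal hχ
  tfae_have 1 → 4 := by
    intro hc
    obtain ⟨Ω, mΩ, P, X, hP, hX, hT⟩ := hTM
    exact ⟨Ω, mΩ, P, X, hP, hX,
      (hX.isSimpleMaxStable.stochasticallyContinuous_iff hT hχ).2 hc, hT⟩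
  tfae_have 4 → 3 := by
    rintro ⟨Ω, mΩ, P, X, hP, hX, hsc, hT⟩
    exact ⟨Ω, mΩ, P, X, hP, hX.isSimpleMaxStable, hsc, hT⟩
  tfae_have 3 → 1 := by
    rintro ⟨Ω, mΩ, P, X, hP, hX, hsc, hT⟩
    exact (hX.stochasticallyContinuous_iff hT hχ).1 hsc
  tfae_finish
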